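/- **Setting.** A *graph* is a simple undirected connected graph with $n\ge 3$ anonymous nodes in which, at each node $v$ of degree $d$, the incident edges carry distinct port numbers $0,\dots,d-1$. The augmented truncated view $\mathcal B^0(v)$ is a single node labelled by the degree of $v$; $\mathcal B^{l+1}(v)$ is the port-labelled tree whose root has, for each neighbour $v_j$ of $v$ (joined to $v$ through port $j$ at $v$ and port $a_j$ at $v_j$), a child at which $\mathcal B^l(v_j)$ is rooted, the edge to this child carrying the ports $j$ and $a_j$. In the $\mathcal{LOCAL}$ model, what a node $v$ does after $r$ rounds (continue, or stop with an output) in a deterministic algorithm with advice is a function of the advice, a binary string common to all nodes, and of $\mathcal B^r(v)$. An algorithm performs *leader election* if every node $v$ stops and outputs the sequence of port numbers $(p_1,q_1,\dots,p_k,q_k)$ of a simple path from $v$ to a node, the leader, that is the same for all $v$. Its *time* is the smallest number of rounds after which all nodes have stopped. A graph $G$ is *feasible* if some algorithm, which may depend on $G$ (the nodes know the map of $G$), performs leader election in $G$; the *election index* $\phi=\phi(G)$ is the minimum time in which this can be done. **Codes.** $\mathrm{bin}(x)$ is the binary representation of an integer $x\ge0$; $\mathrm{Concat}(A_1,\dots,A_k)$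 doubles each digit of each string and puts $01$ between the strings. The code of $\mathcal B^0(v)$ is $\mathrm{bin}(\deg v)$; that of $\mathcal B^{l+1}(v)$ is the $\mathrm{Concat}$, over the ports $j$ at $v$, of $\mathrm{Concat}(\mathrm{bin}(j),\mathrm{bin}(a_j),\mathrm{code}(\mathcal B^{l}(v_j)))$. The code of a rooted tree with ports and labelled nodes is $\mathrm{Concat}(\mathrm{Concat}(S_1),\mathrm{Concat}(S_2))$, where $S_1$ and $S_2$ are the sequences of the codes of the port numbers, respectively of the node labels, met in the DFS walk from the root. A *trie* is a rooted binary tree (left child at port $0$, right child at port $1$) with a query $(a,b)\in\mathbb N^2$, coded $\mathrm{Concat}(\mathrm{bin}(a),\mathrm{bin}(b))$, at each internal node and the label $(0)$ at each leaf; it is coded as a labelled tree. A list of couples $(a_i,L_i)$ is coded $\mathrm{Concat}(\mathrm{bin}(a_1),\mathrm{code}(L_1),\mathrm{bin}(a_2),\mathrm{code}(L_2),\dots)$. **Procedures.** * $\mathtt{LocalLabel}(\mathcal B,X,T)$ ($\mathcal B$ a view, $X$ a list of integers, $T$ a trie) is $1$ if $T$ is a single node. Otherwise let $(x,y)$ be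 the label of the root of $T$ and $T_l,T_r$ its left and right subtries. Go left if $X=()$ and either $x=0$ and the code of $\mathcal B$ is shorter than $y$, or $x=1$ and its $y$-th bit is $0$; if $X\ne()$, go left if the $(x+1)$-th term of $X$ is not $y$; in all other cases go right. Return $\mathtt{LocalLabel}(\mathcal B,X,T_l)$ on the left, and the number of leaves of $T_l$ plus $\mathtt{LocalLabel}(\mathcal B,X,T_r)$ on the right. * $\mathtt{RetrieveLabel}(\mathcal B,E_1,E_2)$, $\mathcal B$ of depth $d\ge1$: if $d=1$, it is $\mathtt{LocalLabel}(\mathcal B,(),E_1)$. If $d\ge2$, let $X$ be the list of the values of $\mathtt{RetrieveLabel}(\cdot,E_1,E_2)$ on the views of depth $d-1$ of the children of the root in port order, let $m$ be its value on the truncation of $\mathcal B$ to depth $d-1$, and let $L$ be the list paired with $d$ in $E_2$. Return the sum over $i=1,\dots,m$ of: $1$ if $L$ has no couple $(i,T)$; the number of leaves of $T$ if it has one and $i<m$; $\mathtt{LocalLabel}(\mathcal B,X,T)$ if it has one and $i=m$. * $\mathtt{BuildTrie}(S,E_1,E_2)$, $S$ a non-empty set of views of the same depth $\ell\ge1$: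 a single leaf if $|S|=1$. Otherwise it is the trie with root label $val$ and left and right subtries $\mathtt{BuildTrie}(S',E_1,E_2)$ and $\mathtt{BuildTrie}(S\setminus S',E_1,E_2)$, as follows. If $E_1=\emptyset$ and the codes of the elements of $S$ have different lengths, of maximum $M$, then $val=(0,M)$ and $S'$ consists of the elements with code shorter than $M$. If $E_1=\emptyset$ and all lengths are equal, then $val=(1,j)$, where $j$ is the first position at which the codes of some elements differ, and $S'$ consists of the elements whose $j$-th bit is $0$. If $E_1\ne\emptyset$, take the two elements of $S$ with lexicographically smallest codes, the smallest port $i$ at which their child subviews of depth $\ell-1$ differ, and the one, $\mathcal B_{disc}$, of these two subviews with the smaller code; then $val=(i,\mathtt{RetrieveLabel}(\mathcal B_{disc},E_1,E_2))$ and $S'$ consists of the elements whose child subview at port $i$ is not $\mathcal B_{disc}$. * $\mathtt{ComputeAdvice}(G)$: let $E_1=\mathtt{BuildTrie}(\{\mathcal B^1(v)\},\emptyset,())$ and $E_2(1)=()$. For $i=2,\dots,\phi$, the list $E_2(i)$ is $E_2(i-1)$ followed by $(i,L(i))$, where $L(i)$ lists, for each view $\mathcal B'$ of depth $i-1$ in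 $G$ (in the lexicographic order of codes) such that $X=\{\mathcal B^i(v):\mathcal B^{i-1}(v)=\mathcal B'\}$ has more than one element, the couple $(\mathtt{RetrieveLabel}(\mathcal B',E_1,E_2(i-1)),\mathtt{BuildTrie}(X,E_1,E_2(i-1)))$. Let $E_2=E_2(\phi)$, and label each node $u$ by $\mathtt{RetrieveLabel}(\mathcal B^\phi(u),E_1,E_2)$. Let $T$ be the so labelled canonical BFS tree of $G$ rooted at the node labelled $1$ (the parent of a node $u$ is its neighbour at the preceding level with the smallest port number at $u$), with the ports of $G$. Return $\mathrm{Concat}(\mathrm{bin}(\phi),\mathrm{Concat}(\mathrm{code}(E_1),\mathrm{code}(E_2)),\mathrm{code}(T))$. * $\mathtt{Elect}$, run by a node $u$ with the advice: decode $\phi,E_1,E_2,T$; exchange views for $\phi$ rounds to get $\mathcal B^\phi(u)$; output the port numbers along the simple path in $T$ from the node labelled $\mathtt{RetrieveLabel}(\mathcal B^\phi(u),E_1,E_2)$ to the root, labelled $1$. **Theorem.** There is a constant $C$ such that, for every $n\ge3$ and every feasible $n$-node graph $G$ with election index $\phi$: 1. $\mathtt{ComputeAdvice}(G)$ terminates and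 returns a binary string of length at most $C\,n\log_2 n$. 2. Using this string as advice, Algorithm $\mathtt{Elect}$ performs leader election in $G$ in time exactly $\phi$; no deterministic algorithm, even one that may depend on $G$, performs leader election in $G$ in time less than $\phi$. -/

import Mathlib

namespace Election

/-! ## Port-numbered graphs -/

/-- A simple undirected connected graph with `n` nodes and port numbers: at every node `v`, the
edges incident to `v` are numbered bijectively by `{0, …, deg v - 1}` (so `deg v` is the degree of
`v`). The names of the nodes (elements of `Fin n`) are not accessible to the nodes. -/
structure PortGraph (n : ℕ) where
  graph : SimpleGraph (Fin n)
  connected : graph.Connected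
  deg : Fin n → ℕ
  port : (v : Fin n) → graph.neighborSet v ≃ Fin (deg v)

namespace PortGraph

variable {n : ℕ}

/-- The neighbour of `v` corresponding to the port number `j` at `v`. -/
def nbr (G : PortGraph n) (v : Fin n) (j : Fin (G.deg v)) : Fin n :=
  ((G.port v).symm j).1

theorem adj_nbr (G : PortGraph n) (v : Fin n) (j : Fin (G.deg v)) :
    G.graph.Adj v (G.nbr v j) :=
  ((G.port v).symm j).2

/-- The port number, at the neighbour of `v` corresponding to port `j`, of the edge joining it
to `v`. -/
def farPort (G : PortGraph n) (v : Fin n) (j : Fin (G.deg v)) : ℕ :=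
  (G.port (G.nbr v j) ⟨v, (G.adj_nbr v j).symm⟩).val

/-- The sequence `(p₁, q₁, …, pₖ, qₖ)` of port numbers along a walk: `pᵢ` and `qᵢ` are the port
numbers of the `i`-th edge at its first and at its second end. -/
def portSeq (G : PortGraph n) : {u v : Fin n} → G.graph.Walk u v → List ℕ
  | _, _, .nil => []
  | u, _, .cons (v := w) h p =>
      (G.port u ⟨w, h⟩).val :: (G.port w ⟨u, h.symm⟩).val :: G.portSeq p

/-- The outputs `P v` of the nodes solve leader election: there is a node, the leader, such that
every `P v` is the sequence of port numbers of a simple path from `v` to the leader. -/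
def IsElection (G : PortGraph n) (P : Fin n → List ℕ) : Prop :=
  ∃ leader : Fin n, ∀ v : Fin n,
    ∃ p : G.graph.Walk v leader, p.IsPath ∧ G.portSeq p = P v

end PortGraph

/-! ## Augmented truncated views -/

/-- Augmented truncated views at depth `d`. At depth `0`, such a view is a single node labelled by
its degree. At depth `d + 1`, it is the list, indexed by the port numbers `j = 0, 1, …` at the
root, of the couples formed of the port number at the `j`-th child of the edge leading to the root
and of the augmented truncated view at depth `d` rooted at this child. -/
def AView : ℕ → Type
  | 0 => ℕ
  | d + 1 => List (ℕ × AView d)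

instance AView.instDecidableEq : (d : ℕ) → DecidableEq (AView d)
  | 0 => inferInstanceAs (DecidableEq ℕ)
  | d + 1 =>
    letI := AView.instDecidableEq d
    inferInstanceAs (DecidableEq (List (ℕ × AView d)))

/-- The augmented truncated view `B^d(v)` of the node `v` at depth `d`. The recursion is also what
the exchange of views does: if all nodes send their views at depth `d` through all their ports,
each of them obtains its view at depth `d + 1`. -/
def PortGraph.view {n : ℕ} (G : PortGraph n) : (d : ℕ) → Fin n → AView d
  | 0, v => G.deg v
  | d + 1, v => List.ofFn fun j : Fin (G.deg v) => (G.farPort v j, G.view d (G.nbr v j))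

namespace AView

/-- The augmented truncated view at depth `d` of the root of a view at depth `d + 1`. -/
def trunc : {d : ℕ} → AView (d + 1) → AView d
  | 0, B => List.length B
  | _ + 1, B => List.map (fun c => (c.1, trunc c.2)) B

/-- The augmented truncated views at depth `d` rooted at the children of the root of a view at
depth `d + 1`, in the order of the port numbers at the root. -/
def children {d : ℕ} (B : AView (d + 1)) : List (AView d) :=
  List.map Prod.snd B

/-- The view rooted at the child of the root corresponding to the port number `i`, if any. -/
def child {d : ℕ} (B : AView (d + 1)) (i : ℕ) : Option (AView d) :=
  B.children[i]?

end AView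

/-! ## Leader election in the LOCAL model -/

/-- A deterministic algorithm in the LOCAL model (once the advice is fixed). What a node `v` knows
after `r` rounds is precisely its augmented truncated view at depth `r`; as a function of it, `v`
either continues (`none`) or stops with an output. -/
def LocalAlgorithm : Type := (r : ℕ) → AView r → Option (List ℕ)

/-- Run on `G`, the algorithm makes the node `v` stop after exactly `r` rounds and output `P`. -/
def LocalAlgorithm.StopsWith {n : ℕ} (alg : LocalAlgorithm) (G : PortGraph n) (v : Fin n)
    (r : ℕ) (P : List ℕ) : Prop :=
  alg r (G.view r v) = some P ∧ ∀ r' < r, alg r' (G.view r' v) = none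

/-- Run on `G`, the algorithm performs leader election, and `t` rounds are sufficient to complete
it by all nodes. -/
def LocalAlgorithm.ElectsWithin {n : ℕ} (alg : LocalAlgorithm) (G : PortGraph n) (t : ℕ) : Prop :=
  ∃ P : Fin n → List ℕ,
    (∀ v, ∃ r ≤ t, alg.StopsWith G v r (P v)) ∧ G.IsElection P

/-- The times sufficient for leader election in `G` when the nodes know the map of `G`, that is,
when the algorithm may depend on `G`. -/
def PortGraph.electionTimes {n : ℕ} (G : PortGraph n) : Set ℕ :=
  {t | ∃ alg : LocalAlgorithm, alg.ElectsWithin G t}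

/-- Leader election is possible in `G` for nodes knowing the map of `G`. -/
def PortGraph.Feasible {n : ℕ} (G : PortGraph n) : Prop :=
  G.electionTimes.Nonempty

/-- The election index of a feasible graph: the minimum time in which leader election can be
performed by nodes knowing the map of the graph. -/
noncomputable def PortGraph.electionIndex {n : ℕ} (G : PortGraph n) : ℕ :=
  sInf G.electionTimes

/-! ## Binary codes -/

abbrev Bits : Type := List Bool

/-- The binary representation of a non-negative integer, the most significant bit first;
`bin 0` is the string `0`. -/
def bin (x : ℕ) : Bits :=
  if x = 0 then [false] else (Nat.bits x).reverse

/-- The integer with a given binary representation. -/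
def unbin (s : Bits) : ℕ :=
  s.foldl (fun a b => 2 * a + b.toNat) 0

/-- Double each digit. -/
def double (s : Bits) : Bits :=
  s.flatMap fun b => [b, b]

/-- `concat [A₁, …, Aₖ]`: double each digit in each substring and put `01` between substrings. -/
def concat (l : List Bits) : Bits :=
  List.intercalate [false, true] (l.map double)

/-- Reads a string two digits at a time: `00` and `11` are doubled digits, `01` separates
substrings. -/
def decodeAux : Bits → Option (List Bits)
  | [] => some [[]]
  | false :: true :: s => (decodeAux s).map fun l => [] :: l
  | false :: false :: s => (decodeAux s).map fun l => (false :: l.headD []) :: l.tail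
  | true :: true :: s => (decodeAux s).map fun l => (true :: l.headD []) :: l.tail
  | _ => none

/-- The decoding function, inverse to `concat`; the empty string is decoded as the empty
sequence. -/
def decode (s : Bits) : Option (List Bits) :=
  if s = [] then some [] else decodeAux s

/-- The canonical binary code of an augmented truncated view. At depth `1` it is
`concat [concat [bin 0, bin a₀, bin b₀], …]`, where `aⱼ` is the port number at the `j`-th
neighbour and `bⱼ` is its degree; at larger depths the code of the view rooted at the `j`-th
child takes the place of `bin bⱼ`. -/
def AView.code : {d : ℕ} → AView d → Bits
  | 0, b => bin b
  | _ + 1, B => concat (List.mapIdx (fun j c => concat [bin j, bin c.1, AView.code c.2]) B)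

/-- The set of the elements of a list of views, as a duplicate-free list sorted
lexicographically by binary codes. Finite sets of views are represented in this way. -/
def viewSet {d : ℕ} (l : List (AView d)) : List (AView d) :=
  l.dedup.insertionSort fun B B' => B.code ≤ B'.code

/-! ### Rooted trees with port numbers and labelled nodes -/

/-- Ordered sequences of subtrees hanging from a common node. In `cons p q x c rest`, the first
subtree has a root labelled `x`, joined to the common node by an edge with port number `p` at the
common node and `q` at this root; `c` is what hangs from this root, and `rest` is the rest of the
sequence. -/
inductive PForest (α : Type) : Type
  | nil : PForest α
  | cons (p q : ℕ) (x : α) (c rest : PForest α) : PForest α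

/-- A rooted tree with port numbers and labelled nodes. -/
structure PTree (α : Type) : Type where
  label : α
  sub : PForest α

/-- The port numbers encountered in the DFS walk (the part inside a forest). -/
def PForest.walk {α : Type} : PForest α → List ℕ
  | .nil => []
  | .cons p q _ c rest => p :: q :: (c.walk ++ q :: p :: rest.walk)

/-- The node labels in the order of visits during the DFS walk, without repetitions. -/
def PForest.labels {α : Type} : PForest α → List α
  | .nil => []
  | .cons _ _ x c rest => x :: (c.labels ++ rest.labels)

/-- The code of a labelled tree, `f` being the code of the labels. -/
def PTree.code {α : Type} (f : α → Bits) (T : PTree α) : Bits :=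
  concat [concat (T.sub.walk.map bin), concat ((T.label :: T.sub.labels).map f)]

/-- Reconstructs the forest hanging from a node from the sequence `s₁` of the port numbers still
to be read and the sequence `s₂` of the labels still to be read, and returns it with what remains
of both; `e` is the port number at the node of the edge leading to its parent (`none` at the
root). The walk goes back to the parent when the port number read is `e`. The first argument
bounds the depth of the recursion. -/
def PForest.parse {α : Type} : ℕ → Option ℕ → List ℕ → List α →
    Option (PForest α × List ℕ × List α)
  | 0, _, _, _ => none
  | _ + 1, _, [], s₂ => some (.nil, [], s₂)
  | k + 1, e, p :: s, s₂ =>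
    if e = some p then some (.nil, p :: s, s₂)
    else
      match s, s₂ with
      | q :: s₁', x :: s₂' =>
        match PForest.parse k (some q) s₁' s₂' with
        | some (c, q' :: p' :: t₁, t₂) =>
          if q' = q ∧ p' = p then
            match PForest.parse k e t₁ t₂ with
            | some (rest, u₁, u₂) => some (.cons p q x c rest, u₁, u₂)
            | none => none
          else none
        | _ => none
      | _, _ => none

/-- The labelled tree with a given code, `g` decoding the labels. -/
def PTree.decode {α : Type} (g : Bits → Option α) (s : Bits) : Option (PTree α) := do
  let [a, b] ← Election.decode s | none
  let s₁ ← Election.decode a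
  let s₂ ← Election.decode b
  let x :: labels ← s₂.mapM g | none
  let (F, [], []) ← PForest.parse (s₁.length + 1) none (s₁.map unbin) labels | none
  return ⟨x, F⟩

/-! ### Tries -/

/-- A trie: a rooted binary tree whose internal nodes are labelled by queries, which are couples
of integers; all leaves are labelled by `(0)`. -/
inductive Trie : Type
  | leaf : Trie
  | node (query : ℕ × ℕ) (left right : Trie) : Trie

namespace Trie

def numLeaves : Trie → ℕ
  | leaf => 1
  | node _ l r => l.numLeaves + r.numLeaves

/-- The binary code of the label of the root of a trie. -/
def rootCode : Trie → Bits
  | leaf => [false]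
  | node (a, b) _ _ => concat [bin a, bin b]

/-- The port number at the root of a subtrie of the edge leading to its parent: the children of an
internal node correspond to ports `0` and `1`, and a leaf has the port `0` only. -/
def parentPort : Trie → ℕ
  | leaf => 0
  | node _ _ _ => 2

/-- What hangs from the root of a trie, seen as a rooted tree with port numbers. -/
def toForest : Trie → PForest Bits
  | leaf => .nil
  | node _ l r =>
    .cons 0 l.parentPort l.rootCode l.toForest
      (.cons 1 r.parentPort r.rootCode r.toForest .nil)

def code (T : Trie) : Bits :=
  PTree.code id ⟨T.rootCode, T.toForest⟩

def ofTree (x : Bits) : PForest Bits → Option Trie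
  | .nil => if x = [false] then some leaf else none
  | .cons _ _ xl cl (.cons _ _ xr cr .nil) => do
    let [a, b] ← Election.decode x | none
    let l ← ofTree xl cl
    let r ← ofTree xr cr
    return node (unbin a, unbin b) l r
  | _ => none

def decode (s : Bits) : Option Trie := do
  let T ← PTree.decode some s
  ofTree T.label T.sub

end Trie

/-! ### Nested lists -/

/-- Lists of couples formed of an integer and of a trie. -/
abbrev TrieList : Type := List (ℕ × Trie)

/-- Nested lists: lists of couples formed of an integer and of a list of couples formed of an
integer and of a trie. -/
abbrev NestedList : Type := List (ℕ × TrieList)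

def codeTrieList (L : TrieList) : Bits :=
  concat (L.flatMap fun c => [bin c.1, c.2.code])

def codeNestedList (L : NestedList) : Bits :=
  concat (L.flatMap fun c => [bin c.1, codeTrieList c.2])

/-- Groups the terms of a sequence of substrings two by two, decoding the first one of each couple
as an integer and the second one by `g`. -/
def decodeCouples {α : Type} (g : Bits → Option α) : List Bits → Option (List (ℕ × α))
  | [] => some []
  | a :: b :: l => do
    let y ← g b
    let rest ← decodeCouples g l
    return (unbin a, y) :: rest
  | _ => none

def decodeTrieList (s : Bits) : Option TrieList :=
  (decode s).bind (decodeCouples Trie.decode)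

def decodeNestedList (s : Bits) : Option NestedList :=
  (decode s).bind (decodeCouples decodeTrieList)

/-! ## The procedures

A procedure returns `none` when an object it looks for does not exist (and, for procedures with a
bound on the depth of the recursion, when this bound is exceeded). -/

/-- The `j`-th bit of a string, bits being numbered from `1`. -/
def nthBit (s : Bits) : ℕ → Option Bool
  | 0 => none
  | j + 1 => s[j]?

/-- The procedure `LocalLabel(B, X, T)`. -/
def localLabel {d : ℕ} (B : AView d) (X : List ℕ) : Trie → Option ℕ
  | .leaf => some 1
  | .node (x, y) l r => do
    let left ←
      if X = [] then
        some (decide ((x = 0 ∧ B.code.length < y) ∨ (x = 1 ∧ nthBit B.code y = some false)))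
      else
        (X[x]?).map fun z => decide (z ≠ y)
    if left then localLabel B X l
    else return l.numLeaves + (← localLabel B X r)

/-- The value of the variable `sum` after the loop of the procedure `RetrieveLabel` in which `i`
goes from `1` to `m`, where `L` and `label` are the variables of that procedure and `loc T` is the
result of the call of `LocalLabel` with the trie `T`. -/
def labelSum (L : TrieList) (label : ℕ) (loc : Trie → Option ℕ) : ℕ → Option ℕ
  | 0 => some 0
  | i + 1 => do
    let sum ← labelSum L label loc i
    match List.lookup (i + 1) L with
    | some T => if i + 1 < label then return sum + T.numLeaves else return sum + (← loc T)
    | none => return sum + 1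

/-- The procedure `RetrieveLabel(B, E₁, E₂)`. -/
def retrieveLabel (E₁ : Trie) (E₂ : NestedList) : {d : ℕ} → AView d → Option ℕ
  | 0, _ => none
  | 1, B => localLabel B [] E₁
  | d + 2, B => do
    let X ← B.children.mapM fun B' => retrieveLabel E₁ E₂ (d := d + 1) B'
    let label ← retrieveLabel E₁ E₂ (d := d + 1) B.trunc
    let L ← List.lookup (d + 2) E₂
    labelSum L label (localLabel B X) label

/-- The discriminatory index of two views: the smallest port number `i` such that the views rooted
at the children corresponding to `i` are different. -/
def discIndex {d : ℕ} (B B' : AView (d + 1)) : Option ℕ :=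
  (List.range B.children.length).find? fun i => B.child i ≠ B'.child i

/-- The discriminatory index and the discriminatory subview of a set of views: they are given by
the two elements of the set with the smallest codes. -/
def discriminate {d : ℕ} : List (AView (d + 1)) → Option (ℕ × AView d)
  | B :: B' :: _ => do
    let i ← discIndex B B'
    let C ← B.child i
    let C' ← B'.child i
    return (i, if C.code ≤ C'.code then C else C')
  | _ => none

/-- The procedure `BuildTrie(S, E₁, E₂)`, for a set `S` of views at positive depth; `none` in the
place of `E₁` stands for the empty trie. The first argument bounds the depth of the recursion. -/
def buildTrie {d : ℕ} : ℕ → List (AView (d + 1)) → Option Trie → NestedList → Option Trie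
  | 0, _, _, _ => none
  | k + 1, S, E₁, E₂ =>
    if S.length = 1 then some .leaf
    else do
      let (val, inS') ← show Option ((ℕ × ℕ) × (AView (d + 1) → Bool)) from
        match E₁ with
        | none =>
          let max := (S.map fun B => B.code.length).foldr Nat.max 0
          if ∃ B ∈ S, ∃ B' ∈ S, B.code.length ≠ B'.code.length then
            some ((0, max), fun B => decide (B.code.length < max))
          else do
            let j ← (List.range' 1 max).find? fun j =>
              decide (∃ B ∈ S, ∃ B' ∈ S, nthBit B.code j ≠ nthBit B'.code j)
            return ((1, j), fun B => decide (nthBit B.code j = some false))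
        | some E => do
          let (i, Bdisc) ← discriminate S
          let y ← retrieveLabel E E₂ Bdisc
          return ((i, y), fun B => decide (B.child i ≠ some Bdisc))
      let l ← buildTrie k (S.filter inS') E₁ E₂
      let r ← buildTrie k (S.filter fun B => !inS' B) E₁ E₂
      return .node val l r

namespace PortGraph

variable {n : ℕ}

/-- The set of all augmented truncated views at depth `d` in `G`. -/
def views (G : PortGraph n) (d : ℕ) : List (AView d) :=
  viewSet ((List.finRange n).map (G.view d))

/-- The set of the augmented truncated views at depth `d + 1` of the nodes of `G` whose augmented
truncated view at depth `d` is `B`. -/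
def viewsOver (G : PortGraph n) {d : ℕ} (B : AView d) : List (AView (d + 1)) :=
  viewSet (((List.finRange n).filter fun u => G.view d u = B).map (G.view (d + 1)))

/-- The list `L(d + 1)` computed by `ComputeAdvice`, from `E₁` and `E₂ = E₂(d)`. -/
def levelList (G : PortGraph n) (k : ℕ) (E₁ : Trie) (E₂ : NestedList) (d : ℕ) : Option TrieList :=
  ((G.views d).filter fun B => 1 < (G.viewsOver B).length).mapM fun B => do
    let j ← retrieveLabel E₁ E₂ B
    let T ← buildTrie k (G.viewsOver B) (some E₁) E₂
    return (j, T)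

/-- The nested list `E₂(i)` computed by `ComputeAdvice` (`E₂(0)` is not used). -/
def nestedList (G : PortGraph n) (k : ℕ) (E₁ : Trie) : ℕ → Option NestedList
  | 0 => some []
  | 1 => some []
  | i + 2 => do
    let E₂ ← G.nestedList k E₁ (i + 1)
    let L ← G.levelList k E₁ E₂ (i + 1)
    return E₂ ++ [(i + 2, L)]

/-- The parent of `u` in the canonical BFS tree rooted at `r`: among the neighbours of `u` at the
preceding level, the one corresponding to the smallest port number at `u`. -/
noncomputable def bfsParent (G : PortGraph n) (r u : Fin n) : Option (Fin n) :=
  ((List.finRange (G.deg u)).find? fun j =>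
    G.graph.dist r (G.nbr u j) + 1 = G.graph.dist r u).map (G.nbr u)

/-- The port numbers at `u` leading to its children in the canonical BFS tree rooted at `r`, in
increasing order. -/
noncomputable def bfsChildPorts (G : PortGraph n) (r u : Fin n) : List (Fin (G.deg u)) :=
  (List.finRange (G.deg u)).filter fun j => G.bfsParent r (G.nbr u j) = some u

/-- What hangs from `u` in the canonical BFS tree rooted at `r`, up to `m` levels below `u`, with
each node `w` labelled by `lab w`. -/
noncomputable def bfsForest {α : Type} (G : PortGraph n) (r : Fin n) (lab : Fin n → α) :
    ℕ → Fin n → PForest α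
  | 0, _ => .nil
  | m + 1, u => (G.bfsChildPorts r u).foldr
      (fun j rest => .cons j.val (G.farPort u j) (lab (G.nbr u j))
        (G.bfsForest r lab m (G.nbr u j)) rest) .nil

/-- The canonical BFS tree of `G` rooted at `r` (it has less than `n` levels below `r`), with each
node `w` labelled by `lab w`. -/
noncomputable def bfsTree {α : Type} (G : PortGraph n) (r : Fin n) (lab : Fin n → α) : PTree α :=
  ⟨lab r, G.bfsForest r lab n r⟩

end PortGraph

/-- The procedure `ComputeAdvice(G)`, with the depth of the recursion of `BuildTrie` bounded
by `k`. -/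
noncomputable def computeAdvice {n : ℕ} (k : ℕ) (G : PortGraph n) : Option Bits := do
  let φ := G.electionIndex
  let E₁ ← buildTrie k (G.views 1) none []
  let E₂ ← G.nestedList k E₁ φ
  let labels ← (List.finRange n).mapM fun u => retrieveLabel E₁ E₂ (G.view φ u)
  let lab : Fin n → ℕ := fun u => labels.getD u.val 0
  let r ← (List.finRange n).find? fun u => lab u = 1
  let A₁ := concat [E₁.code, codeNestedList E₂]
  let A₂ := (G.bfsTree r lab).code bin
  return concat [bin φ, A₁, A₂]

/-- `ComputeAdvice(G)` terminates and returns the string `adv`: whenever the bound on the depth of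
the recursion is large enough, the result is `adv`. -/
def ComputeAdviceReturns {n : ℕ} (G : PortGraph n) (adv : Bits) : Prop :=
  ∃ k₀ : ℕ, ∀ k ≥ k₀, computeAdvice k G = some adv

/-! ## Algorithm Elect -/

/-- The port numbers along the path from the node labelled `x` to the node from which the forest
hangs, if there is a node labelled `x` in the forest. -/
def PForest.pathUp (x : ℕ) : PForest ℕ → Option (List ℕ)
  | .nil => none
  | .cons p q y c rest =>
    if y = x then some [q, p]
    else
      match c.pathUp x with
      | some l => some (l ++ [q, p])
      | none => rest.pathUp x

/-- The port numbers along the unique simple path in the tree from the node labelled `x` to the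
root. -/
def PTree.pathToRoot (x : ℕ) (T : PTree ℕ) : Option (List ℕ) :=
  if T.label = x then some [] else T.sub.pathUp x

/-- Decodes the election index, `E₁`, `E₂` and the labelled BFS tree from the advice. -/
def decodeAdvice (adv : Bits) : Option (ℕ × Trie × NestedList × PTree ℕ) := do
  let [a, A₁, A₂] ← decode adv | none
  let [s, t] ← decode A₁ | none
  let E₁ ← Trie.decode s
  let E₂ ← decodeNestedList t
  let T ← PTree.decode (fun b => some (unbin b)) A₂
  return (unbin a, E₁, E₂, T)

/-- Algorithm `Elect`, using the advice `adv`: a node exchanges views with its neighbours until it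
has its augmented truncated view at depth `φ`, where `φ` is the integer decoded from the advice;
then it computes its label, and outputs the port numbers along the path from the node with this
label to the root (labelled `1`) of the tree decoded from the advice. -/
def elect (adv : Bits) : LocalAlgorithm := fun r B => do
  let (φ, E₁, E₂, T) ← decodeAdvice adv
  if r = φ then
    let x ← retrieveLabel E₁ E₂ B
    T.pathToRoot x
  else none

end Election

/-!
Two nodes with the same view at depth `t` behave in the same way during the first `t` rounds, and a
sequence of port numbers together with the end of a path determines its origin. Hence an election
in time `t` separates all nodes by their views at depth `t`; conversely, if these views are
distinct, then nodes that know the map can compute a path to a fixed leader. So the election index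
`φ` is the least depth at which all views are distinct
(`PortGraph.view_injective_of_mem_electionTimes`,
`PortGraph.mem_electionTimes_of_view_injective`). It is positive, as two nodes of a graph have the
same degree, and at most `n`, as the number of distinct views increases at each depth less than
`φ`.

`RetrieveLabel` numbers the distinct views of each depth `d` from `1` to their number
(`IsLabeling`). At depth `1` this is the work of the trie `E₁`: its queries split any set of at
least two views, because their codes are distinct (`rootQuery_none`). At depth `d + 1`, two distinct
views with the same truncation to depth `d` differ in their subviews at some port, and the label of
one of these subviews tells them apart (`rootQuery_some`). So `BuildTrie` finds a trie that
separates the views with a given truncation (`exists_buildTrie`), and such a trie numbers them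
(`Separates.exists_localLabel`). These numbers, shifted by the number of views whose truncations
have smaller labels, are the labels at depth `d + 1` (`exists_levelList`). At depth `φ` the labels
are therefore distinct names `1, …, n` of the nodes, and the path in the BFS tree from the node
labelled `x` to the root is a shortest path of `G`
(`PortGraph.exists_path_of_pathToRoot`). The codes are decodable: `concat` is inverted by `decode`
but for one degenerate sequence, and the DFS walk of a tree can be parsed since the port number
towards the parent is not the port number towards a child (`PForest.parse_walk`).

For the length, let `b = O(log n)` bound the number of bits of all integers in the advice. The trie
`E₁` has at most `n` leaves. Each internal node of a trie in `E₂` for depth `d + 1` accounts for one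
more view at depth `d + 1` than at depth `d`, so that all tries of `E₂` together have at most `2n`
leaves (`exists_nestedList`). The BFS tree has `n` nodes, and `E₂` has less than `n` levels.
Hence the advice has `O(n b)` bits (`length_advice_le`).
-/

namespace Election

/-! ### Binary codes and their decoding -/

theorem unbin_append_singleton (s : Bits) (b : Bool) :
    unbin (s ++ [b]) = 2 * unbin s + b.toNat := by
  simp [unbin]

theorem unbin_reverse_bits (x : ℕ) : unbin (Nat.bits x).reverse = x := by
  induction x using Nat.binaryRec' with
  | zero => rfl
  | bit b n h ih =>
    rw [Nat.bits_append_bit n b h, List.reverse_cons, unbin_append_singleton, ih, Nat.bit_val]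

theorem unbin_bin (x : ℕ) : unbin (bin x) = x := by
  unfold bin
  split_ifs with h
  · subst h; rfl
  · exact unbin_reverse_bits x

theorem bin_ne_nil (x : ℕ) : bin x ≠ [] := by
  intro h
  have h' := unbin_bin x
  rw [h] at h'
  obtain rfl : 0 = x := h'
  simp [bin] at h

theorem length_bin_le {x b : ℕ} (hb : 1 ≤ b) (hx : x < 2 ^ b) : (bin x).length ≤ b := by
  unfold bin
  split_ifs with h
  · exact hb
  · rw [List.length_reverse, Nat.size_eq_bits_len]
    exact Nat.size_le.2 hx

theorem length_double (s : Bits) : (double s).length = 2 * s.length := by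
  simp [double, mul_comm]

theorem concat_nil : concat [] = [] := rfl

theorem concat_singleton (a : Bits) : concat [a] = double a := by
  simp [concat, List.intercalate]

theorem concat_cons_cons (a b : Bits) (l : List Bits) :
    concat (a :: b :: l) = double a ++ (false :: true :: concat (b :: l)) := by
  simp [concat, List.intercalate]

theorem length_concat_le (l : List Bits) :
    (concat l).length ≤ (l.map fun a => 2 * a.length + 2).sum := by
  induction l with
  | nil => simp [concat_nil]
  | cons a l ih =>
    cases l with
    | nil => simp [concat_singleton, length_double]
    | cons b l =>
      rw [concat_cons_cons]
      simp only [List.length_append, List.length_cons, length_double, List.map_cons,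
        List.sum_cons] at ih ⊢
      omega

theorem length_concat_le_mul (l : List Bits) {c : ℕ} (h : ∀ a ∈ l, a.length ≤ c) :
    (concat l).length ≤ l.length * (2 * c + 2) := by
  refine (length_concat_le l).trans ?_
  have := List.sum_le_card_nsmul (l.map fun a => 2 * a.length + 2) (2 * c + 2) (by
    intro x hx
    obtain ⟨a, ha, rfl⟩ := List.mem_map.1 hx
    have := h a ha
    omega)
  simpa using this

theorem decodeAux_double_append (s t : Bits) {l : List Bits} (hl : l ≠ [])
    (h : decodeAux t = some l) :
    decodeAux (double s ++ t) = some ((s ++ l.headD []) :: l.tail) := by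
  induction s with
  | nil =>
    cases l with
    | nil => exact absurd rfl hl
    | cons a l => simpa [double] using h
  | cons b s ih =>
    have hd : double (b :: s) ++ t = b :: b :: (double s ++ t) := by simp [double]
    rw [hd]
    cases b <;> simp [decodeAux, ih]

theorem decodeAux_concat {l : List Bits} (hl : l ≠ []) : decodeAux (concat l) = some l := by
  induction l with
  | nil => exact absurd rfl hl
  | cons a l ih =>
    cases l with
    | nil =>
      have := decodeAux_double_append a [] (l := [[]]) (by simp) (by simp [decodeAux])
      simpa [concat_singleton] using this
    | cons b l =>
      rw [concat_cons_cons, decodeAux_double_append a _ (l := [] :: b :: l) (by simp)]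
      · simp
      · simp [decodeAux, ih]

/-- `decode` inverts `concat`, except on the one-term sequence formed of the empty string, which
has the same code as the empty sequence. -/
theorem decode_concat {l : List Bits} (hl : l ≠ [[]]) : decode (concat l) = some l := by
  unfold decode
  rcases l with _ | ⟨a, l⟩
  · simp [concat_nil]
  · rw [if_neg, decodeAux_concat (by simp)]
    intro h
    have := decodeAux_concat (l := a :: l) (by simp)
    rw [h] at this
    simp [decodeAux] at this
    exact hl (by rw [this.1, this.2])

theorem concat_injOn {l l' : List Bits} (hl : l ≠ [[]]) (hl' : l' ≠ [[]])
    (h : concat l = concat l') : l = l' := by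
  have h1 := decode_concat hl
  rw [h, decode_concat hl'] at h1
  exact (Option.some.inj h1).symm

theorem concat_eq_nil {l : List Bits} (hl : l ≠ [[]]) (h : concat l = []) : l = [] :=
  concat_injOn hl (by simp) (by simpa [concat_nil] using h)

theorem ne_singleton_nil_of_forall {l : List Bits} (h : ∀ a ∈ l, a ≠ []) : l ≠ [[]] := by
  rintro rfl
  exact h [] (by simp) rfl

/-! ### Decoding labelled trees and tries -/

variable {α : Type}

/-- The number of nodes of a forest. -/
def PForest.size : PForest α → ℕ
  | .nil => 0
  | .cons _ _ _ c rest => c.size + rest.size + 1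

/-- In the forest hanging from a node whose edge to its parent has port number `e` there (`none`
at the root), no edge from a node to a child has the port number of the edge to the parent. This
is what makes the DFS walk decodable. -/
def PForest.PortsAvoid : Option ℕ → PForest α → Prop
  | _, .nil => True
  | e, .cons p q _ c rest => e ≠ some p ∧ c.PortsAvoid (some q) ∧ rest.PortsAvoid e

theorem PForest.length_walk (F : PForest α) : F.walk.length = 4 * F.size := by
  induction F with
  | nil => rfl
  | cons p q x c rest ihc ihr => simp [walk, size, ihc, ihr]; ring

theorem PForest.length_labels (F : PForest α) : F.labels.length = F.size := by
  induction F with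
  | nil => rfl
  | cons p q x c rest ihc ihr => simp [labels, size, ihc, ihr]

theorem PForest.parse_walk (F : PForest α) : ∀ (e : Option ℕ) (k : ℕ) (t : List ℕ) (u : List α),
    F.PortsAvoid e → F.size < k → (t = [] ∨ ∃ p t', e = some p ∧ t = p :: t') →
    PForest.parse k e (F.walk ++ t) (F.labels ++ u) = some (F, t, u) := by
  induction F with
  | nil =>
    intro e k t u _ hk ht
    obtain ⟨k, rfl⟩ := Nat.exists_eq_add_one_of_ne_zero (Nat.ne_zero_of_lt hk)
    rcases ht with rfl | ⟨p, t', rfl, rfl⟩ <;> simp [parse, walk, labels]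
  | cons p q x c rest ihc ihr =>
    intro e k t u hF hk ht
    obtain ⟨k, rfl⟩ := Nat.exists_eq_add_one_of_ne_zero (Nat.ne_zero_of_lt hk)
    obtain ⟨he, hc, hr⟩ := hF
    simp only [size] at hk
    have h1 := ihc (some q) k (q :: p :: (rest.walk ++ t)) (rest.labels ++ u) hc (by omega)
      (Or.inr ⟨q, _, rfl, rfl⟩)
    have h2 := ihr e k t u hr (by omega) ht
    simp [parse, walk, labels, he, h1, h2]

theorem PTree.decode_code {f : α → Bits} {g : Bits → Option α} (T : PTree α)
    (hg : ∀ x ∈ T.label :: T.sub.labels, g (f x) = some x)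
    (hf : ∀ x ∈ T.label :: T.sub.labels, f x ≠ []) (hT : T.sub.PortsAvoid none) :
    PTree.decode g (T.code f) = some T := by
  have h1 : Election.decode (T.code f) =
      some [concat (T.sub.walk.map bin), concat ((T.label :: T.sub.labels).map f)] :=
    decode_concat (by simp)
  have h2 : Election.decode (concat (T.sub.walk.map bin)) = some (T.sub.walk.map bin) :=
    decode_concat (ne_singleton_nil_of_forall (by simp [bin_ne_nil]))
  have h3 : Election.decode (concat ((T.label :: T.sub.labels).map f)) =
      some ((T.label :: T.sub.labels).map f) := by
    refine decode_concat (ne_singleton_nil_of_forall fun a ha => ?_)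
    obtain ⟨x, hx, rfl⟩ := List.mem_map.1 ha
    exact hf x hx
  have h4 : ∀ l : List α, (∀ x ∈ l, g (f x) = some x) → (l.map f).mapM g = some l := by
    intro l
    induction l with
    | nil => intro _; rfl
    | cons a l ih =>
      intro h
      simp [List.mapM_cons, h a (by simp), ih fun x hx => h x (by simp [hx])]
  have h5 : (T.sub.walk.map bin).map unbin = T.sub.walk := by
    rw [List.map_map]
    exact (List.map_congr_left fun x _ => unbin_bin x).trans (List.map_id _)
  have h6 := PForest.parse_walk T.sub none ((T.sub.walk.map bin).length + 1) [] [] hT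
    (by rw [List.length_map, PForest.length_walk]; omega) (Or.inl rfl)
  rw [List.append_nil, List.append_nil] at h6
  simp only [PTree.decode, h1, h2, h3, h4 _ hg, h5, h6, Option.bind_eq_bind, Option.bind_some]
  rfl

namespace Trie

theorem rootCode_ne_nil (T : Trie) : T.rootCode ≠ [] := by
  cases T with
  | leaf => simp [rootCode]
  | node q l r =>
    intro h
    have := concat_eq_nil (l := [bin q.1, bin q.2]) (by simp) h
    simp at this

theorem labels_toForest_ne_nil (T : Trie) : ∀ x ∈ T.toForest.labels, x ≠ [] := by
  induction T with
  | leaf => simp [toForest, PForest.labels]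
  | node q l r ihl ihr =>
    intro x hx
    simp only [toForest, PForest.labels, List.mem_cons, List.mem_append, List.not_mem_nil,
      or_false] at hx
    rcases hx with rfl | hx | rfl | hx
    · exact rootCode_ne_nil l
    · exact ihl x hx
    · exact rootCode_ne_nil r
    · exact ihr x hx

theorem portsAvoid_toForest (T : Trie) :
    ∀ e : Option ℕ, (e = none ∨ e = some T.parentPort) → T.toForest.PortsAvoid e := by
  induction T with
  | leaf => intro e _; trivial
  | node q l r ihl ihr =>
    intro e he
    have h : e ≠ some 0 ∧ e ≠ some 1 := by
      rcases he with rfl | rfl <;> simp [parentPort]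
    exact ⟨h.1, ihl _ (Or.inr rfl), h.2, ihr _ (Or.inr rfl), trivial⟩

theorem ofTree_toForest (T : Trie) : ofTree T.rootCode T.toForest = some T := by
  induction T with
  | leaf => simp [rootCode, toForest, ofTree]
  | node q l r ihl ihr =>
    have h : Election.decode (rootCode (node q l r)) = some [bin q.1, bin q.2] :=
      decode_concat (by simp)
    simp [toForest, ofTree, ihl, ihr, h, unbin_bin]

theorem decode_code (T : Trie) : Trie.decode T.code = some T := by
  have h := PTree.decode_code (f := id) (g := some) ⟨T.rootCode, T.toForest⟩ (by simp)
    (by simpa using ⟨rootCode_ne_nil T, labels_toForest_ne_nil T⟩)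
    (portsAvoid_toForest T none (Or.inl rfl))
  simp [Trie.decode, Trie.code, h, ofTree_toForest]

end Trie

theorem decodeCouples_flatMap {f : α → Bits} {g : Bits → Option α} (hg : ∀ x, g (f x) = some x)
    (L : List (ℕ × α)) :
    decodeCouples g (L.flatMap fun c => [bin c.1, f c.2]) = some L := by
  induction L with
  | nil => rfl
  | cons c L ih =>
    simp only [List.flatMap_cons, List.cons_append, List.nil_append]
    simp [decodeCouples, hg, ih, unbin_bin]

theorem flatMap_couples_ne {f : α → Bits} (L : List (ℕ × α)) :
    (L.flatMap fun c => [bin c.1, f c.2]) ≠ [[]] := by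
  cases L <;> simp

theorem decodeTrieList_code (L : TrieList) : decodeTrieList (codeTrieList L) = some L := by
  simp [decodeTrieList, codeTrieList, decode_concat (flatMap_couples_ne L),
    decodeCouples_flatMap Trie.decode_code]

theorem decodeNestedList_code (L : NestedList) :
    decodeNestedList (codeNestedList L) = some L := by
  simp [decodeNestedList, codeNestedList, decode_concat (flatMap_couples_ne L),
    decodeCouples_flatMap decodeTrieList_code]

theorem decodeAdvice_concat (φ : ℕ) (E₁ : Trie) (E₂ : NestedList) (T : PTree ℕ)
    (hT : T.sub.PortsAvoid none) :
    decodeAdvice (concat [bin φ, concat [E₁.code, codeNestedList E₂], T.code bin]) =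
      some (φ, E₁, E₂, T) := by
  have h := PTree.decode_code (f := bin) (g := fun b => some (unbin b)) T
    (by simp [unbin_bin]) (by simp [bin_ne_nil]) hT
  simp [decodeAdvice, decode_concat, Trie.decode_code, decodeNestedList_code, h, unbin_bin]

/-! ### Lengths of codes -/

namespace PTree

theorem length_code_le (T : PTree α) {f : α → Bits} {b c : ℕ} (hb : 1 ≤ b)
    (hw : ∀ p ∈ T.sub.walk, p < 2 ^ b) (hl : ∀ x ∈ T.label :: T.sub.labels, (f x).length ≤ c) :
    (T.code f).length ≤
      2 * (4 * T.sub.size * (2 * b + 2)) + 2 * ((T.sub.size + 1) * (2 * c + 2)) + 4 := by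
  have h1 := length_concat_le_mul (T.sub.walk.map bin) (c := b) (by
    intro a ha
    obtain ⟨x, hx, rfl⟩ := List.mem_map.1 ha
    exact length_bin_le hb (hw x hx))
  have h2 := length_concat_le_mul ((T.label :: T.sub.labels).map f) (c := c) (by
    intro a ha
    obtain ⟨x, hx, rfl⟩ := List.mem_map.1 ha
    exact hl x hx)
  have h3 := length_concat_le
    [concat (T.sub.walk.map bin), concat ((T.label :: T.sub.labels).map f)]
  rw [List.length_map, PForest.length_walk] at h1
  rw [List.length_map, List.length_cons, PForest.length_labels] at h2
  simp only [List.map_cons, List.sum_cons, List.map_nil, List.sum_nil] at h3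
  unfold PTree.code
  simp only [List.map_cons] at h2 h3 ⊢
  omega

end PTree

namespace Trie

/-- All queries of a trie satisfy `P`. -/
def AllQueries (P : ℕ × ℕ → Prop) : Trie → Prop
  | leaf => True
  | node q l r => P q ∧ l.AllQueries P ∧ r.AllQueries P

theorem numLeaves_pos (T : Trie) : 1 ≤ T.numLeaves := by
  induction T with
  | leaf => exact le_rfl
  | node q l r ihl ihr => simp only [numLeaves]; omega

theorem size_toForest (T : Trie) : T.toForest.size + 2 = 2 * T.numLeaves := by
  induction T with
  | leaf => rfl
  | node q l r ihl ihr => simp only [toForest, PForest.size, numLeaves]; omega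

theorem parentPort_le (T : Trie) : T.parentPort ≤ 2 := by
  cases T <;> simp [parentPort]

theorem walk_toForest_le (T : Trie) : ∀ p ∈ T.toForest.walk, p ≤ 2 := by
  induction T with
  | leaf => simp [toForest, PForest.walk]
  | node q l r ihl ihr =>
    intro p hp
    have h1 := parentPort_le l
    have h2 := parentPort_le r
    simp only [toForest, PForest.walk, List.mem_cons, List.mem_append, List.not_mem_nil,
      or_false] at hp
    rcases hp with rfl | rfl | (hp | rfl | rfl | rfl | rfl | hp | rfl | rfl) <;>
      first | omega | exact ihl p hp | exact ihr p hp

theorem length_rootCode_le {b : ℕ} (hb : 1 ≤ b) {T : Trie}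
    (hT : T.AllQueries fun q => q.1 < 2 ^ b ∧ q.2 < 2 ^ b) : T.rootCode.length ≤ 4 * b + 4 := by
  cases T with
  | leaf => simp [rootCode]
  | node q l r =>
    have h := length_concat_le [bin q.1, bin q.2]
    have h1 := length_bin_le hb hT.1.1
    have h2 := length_bin_le hb hT.1.2
    simp only [List.map_cons, List.sum_cons, List.map_nil, List.sum_nil] at h
    simp only [rootCode]
    omega

theorem length_labels_toForest_le {b : ℕ} (hb : 1 ≤ b) {T : Trie}
    (hT : T.AllQueries fun q => q.1 < 2 ^ b ∧ q.2 < 2 ^ b) :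
    ∀ x ∈ T.toForest.labels, x.length ≤ 4 * b + 4 := by
  induction T with
  | leaf => simp [toForest, PForest.labels]
  | node q l r ihl ihr =>
    intro x hx
    simp only [toForest, PForest.labels, List.mem_cons, List.mem_append, List.not_mem_nil,
      or_false] at hx
    rcases hx with rfl | hx | rfl | hx
    · exact length_rootCode_le hb hT.2.1
    · exact ihl hT.2.1 x hx
    · exact length_rootCode_le hb hT.2.2
    · exact ihr hT.2.2 x hx

/-- The code of a trie whose queries have at most `b` bits is linear in `b` times its number of
leaves. -/
theorem length_code_le {b : ℕ} (hb : 2 ≤ b) {T : Trie}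
    (hT : T.AllQueries fun q => q.1 < 2 ^ b ∧ q.2 < 2 ^ b) :
    T.code.length ≤ 150 * (T.numLeaves * b) := by
  have h := PTree.length_code_le (b := b) (c := 4 * b + 4) ⟨T.rootCode, T.toForest⟩ (f := id)
    (by omega) (fun p hp => by
      have h1 := walk_toForest_le T p hp
      have h2 : 2 ^ 2 ≤ 2 ^ b := Nat.pow_le_pow_right (by norm_num) hb
      omega) (by
      intro x hx
      rcases List.mem_cons.1 hx with rfl | hx
      · exact length_rootCode_le (by omega) hT
      · exact length_labels_toForest_le (by omega) hT x hx)
  have hs := size_toForest T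
  have hp := numLeaves_pos T
  obtain ⟨m, hm⟩ : ∃ m, T.numLeaves = m + 1 := ⟨T.numLeaves - 1, by omega⟩
  have hs' : T.toForest.size = 2 * m := by omega
  simp only [hs'] at h
  unfold code
  rw [hm]
  nlinarith [Nat.zero_le (m * b), Nat.mul_le_mul_left m hb]

end Trie

theorem length_concat_couples_le {f : α → Bits} {b : ℕ} (hb : 1 ≤ b) (L : List (ℕ × α))
    (hL : ∀ c ∈ L, c.1 < 2 ^ b) :
    (concat (L.flatMap fun c => [bin c.1, f c.2])).length ≤
      (L.map fun c => 2 * b + 4 + 2 * (f c.2).length).sum := by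
  refine (length_concat_le _).trans ?_
  induction L with
  | nil => simp
  | cons c L ih =>
    have h := ih fun c hc => hL c (by simp [hc])
    have h1 := length_bin_le hb (hL c (by simp))
    simp only [List.flatMap_cons, List.cons_append, List.nil_append, List.map_cons,
      List.sum_cons] at h ⊢
    omega

/-! ### Views and the election index -/

section Views

variable {n : ℕ} (G : PortGraph n)

namespace PortGraph

theorem nbr_port {u w : Fin n} (h : G.graph.Adj u w) : G.nbr u (G.port u ⟨w, h⟩) = w := by
  simp [nbr]

theorem port_nbr (u : Fin n) (j : Fin (G.deg u)) (h : G.graph.Adj u (G.nbr u j)) :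
    G.port u ⟨G.nbr u j, h⟩ = j := by
  simp [nbr]

theorem nbr_injective (u : Fin n) : Function.Injective (G.nbr u) :=
  Subtype.val_injective.comp (G.port u).symm.injective

theorem trunc_view (d : ℕ) (v : Fin n) : (G.view (d + 1) v).trunc = G.view d v := by
  induction d generalizing v with
  | zero => exact List.length_ofFn
  | succ d ih =>
    change List.map (fun c : ℕ × AView (d + 1) => (c.1, c.2.trunc))
      (List.ofFn fun j => (G.farPort v j, G.view (d + 1) (G.nbr v j))) =
      List.ofFn fun j => (G.farPort v j, G.view d (G.nbr v j))
    simp only [List.map_ofFn, Function.comp_def, ih]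

theorem children_view (d : ℕ) (v : Fin n) :
    (G.view (d + 1) v).children = List.ofFn fun j => G.view d (G.nbr v j) := by
  simp only [AView.children, view, List.map_ofFn, Function.comp_def]

theorem view_of_view_succ {d : ℕ} {u v : Fin n} (h : G.view (d + 1) u = G.view (d + 1) v) :
    G.view d u = G.view d v := by
  rw [← trunc_view, h, trunc_view]

theorem view_of_view_le {d d' : ℕ} (hd : d' ≤ d) {u v : Fin n} (h : G.view d u = G.view d v) :
    G.view d' u = G.view d' v := by
  induction d, hd using Nat.le_induction with
  | base => exact h
  | succ d _ ih => exact ih (view_of_view_succ G h)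

theorem deg_of_view {d : ℕ} {u v : Fin n} (h : G.view d u = G.view d v) : G.deg u = G.deg v :=
  view_of_view_le G (Nat.zero_le d) h

/-- The sequence of port numbers along a walk determines its first node, given its last one. -/
theorem start_eq_of_portSeq_eq {u v w : Fin n} (p : G.graph.Walk u w) (q : G.graph.Walk v w)
    (h : G.portSeq p = G.portSeq q) : u = v := by
  induction p generalizing v with
  | nil =>
    cases q with
    | nil => rfl
    | cons => simp [portSeq] at h
  | cons hu p ih =>
    cases q with
    | nil => simp [portSeq] at h
    | cons hv q =>
      simp only [portSeq, List.cons.injEq] at h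
      obtain ⟨-, h1, h2⟩ := h
      obtain rfl := ih q h2
      have h3 := (G.port _).injective (Fin.ext h1)
      exact congrArg Subtype.val h3

theorem portSeq_append {u v w : Fin n} (p : G.graph.Walk u v) (q : G.graph.Walk v w) :
    G.portSeq (p.append q) = G.portSeq p ++ G.portSeq q := by
  induction p with
  | nil => rfl
  | cons h p ih => simp [portSeq, ih]

/-- If an election is possible in time `t`, then no two nodes have the same view at depth `t`:
they would stop at the same time with the same output. -/
theorem view_injective_of_mem_electionTimes {t : ℕ} (ht : t ∈ G.electionTimes) :
    Function.Injective (G.view t) := by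
  obtain ⟨alg, P, hrun, leader, hP⟩ := ht
  intro u v huv
  obtain ⟨r, hr, hu, hu'⟩ := hrun u
  obtain ⟨s, hs, hv, hv'⟩ := hrun v
  have hrs : r = s := by
    rcases lt_trichotomy r s with h | h | h
    · have := hv' r h
      rw [← view_of_view_le G hr huv, hu] at this
      cases this
    · exact h
    · have := hu' s h
      rw [view_of_view_le G hs huv, hv] at this
      cases this
  subst hrs
  rw [view_of_view_le G hr huv, hv] at hu
  obtain ⟨p, -, hp⟩ := hP u
  obtain ⟨q, -, hq⟩ := hP v
  exact start_eq_of_portSeq_eq G p q (by rw [hp, hq, Option.some.inj hu])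

/-- If all views at depth `t` are distinct, then an algorithm made for `G` recognizes each node
by its view at depth `t`, and outputs a path to a fixed leader chosen in advance. -/
theorem mem_electionTimes_of_view_injective [NeZero n] {t : ℕ}
    (ht : Function.Injective (G.view t)) : t ∈ G.electionTimes := by
  classical
  have hpath : ∀ v, ∃ p : G.graph.Walk v 0, p.IsPath := fun v =>
    let ⟨p⟩ := G.connected.preconnected v 0
    ⟨p.toPath.1, p.toPath.2⟩
  choose p hp using hpath
  let alg : LocalAlgorithm := fun r B => if h : ∃ v, r = t ∧ G.view r v = B then
    some (G.portSeq (p h.choose)) else none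
  refine ⟨alg, fun v => G.portSeq (p v), fun v => ⟨t, le_rfl, ?_, ?_⟩,
    0, fun v => ⟨p v, hp v, rfl⟩⟩
  · have h : ∃ w, t = t ∧ G.view t w = G.view t v := ⟨v, rfl, rfl⟩
    have hw := ht h.choose_spec.2
    exact (dif_pos h).trans (by rw [hw])
  · intro r hr
    refine dif_neg ?_
    rintro ⟨-, h, -⟩
    omega

theorem view_electionIndex_injective (hG : G.Feasible) :
    Function.Injective (G.view G.electionIndex) :=
  view_injective_of_mem_electionTimes G (Nat.sInf_mem hG)

theorem electionIndex_le_of_view_injective [NeZero n] {t : ℕ}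
    (ht : Function.Injective (G.view t)) : G.electionIndex ≤ t :=
  Nat.sInf_le (mem_electionTimes_of_view_injective G ht)

/-- The number of distinct augmented truncated views at depth `d`. -/
def numViews (d : ℕ) : ℕ := (Finset.univ.image (G.view d)).card

theorem numViews_le (d : ℕ) : G.numViews d ≤ n :=
  Finset.card_image_le.trans (by simp)

theorem image_trunc_views (d : ℕ) :
    (Finset.univ.image (G.view (d + 1))).image AView.trunc = Finset.univ.image (G.view d) := by
  simp only [Finset.image_image, Function.comp_def, trunc_view]

theorem numViews_le_succ (d : ℕ) : G.numViews d ≤ G.numViews (d + 1) := by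
  rw [numViews, ← image_trunc_views]
  exact Finset.card_image_le

theorem view_succ_of_view_of_numViews_eq {d : ℕ} (h : G.numViews (d + 1) = G.numViews d)
    {u v : Fin n} (huv : G.view d u = G.view d v) : G.view (d + 1) u = G.view (d + 1) v := by
  have h1 : Set.InjOn AView.trunc
      (↑(Finset.univ.image (G.view (d + 1))) : Set (AView (d + 1))) := by
    rw [← Finset.card_image_iff, image_trunc_views]
    exact h.symm
  exact h1 (by simp) (by simp) (by rw [trunc_view, trunc_view, huv])

/-- If one more round does not separate any nodes, then no later round does. -/
theorem view_add_of_view {d : ℕ} (h : ∀ u v, G.view d u = G.view d v →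
    G.view (d + 1) u = G.view (d + 1) v) (m : ℕ) :
    ∀ u v, G.view d u = G.view d v → G.view (d + m) u = G.view (d + m) v := by
  have step : ∀ e, (∀ u v, G.view e u = G.view e v → G.view (e + 1) u = G.view (e + 1) v) →
      ∀ u v, G.view (e + 1) u = G.view (e + 1) v → G.view (e + 2) u = G.view (e + 2) v := by
    intro e he u v huv
    classical
    -- views at depth `e + 1` are a function `F` of those at depth `e`, hence the same for `e + 2`
    let F : AView e → AView (e + 1) := fun B =>
      if hB : ∃ w, G.view e w = B then G.view (e + 1) hB.choose else G.view (e + 1) u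
    have hF : ∀ w, F (G.view e w) = G.view (e + 1) w := by
      intro w
      have hw : ∃ w', G.view e w' = G.view e w := ⟨w, rfl⟩
      simp only [F, dif_pos hw]
      exact he _ _ hw.choose_spec
    have hmap : ∀ w, G.view (e + 2) w =
        List.map (fun c : ℕ × AView e => (c.1, F c.2)) (G.view (e + 1) w) := by
      intro w
      rw [view, view, List.map_ofFn]
      simp only [Function.comp_def, hF]
      rfl
    rw [hmap, hmap, huv]
  have all : ∀ e, ∀ u v, G.view (d + e) u = G.view (d + e) v →
      G.view (d + e + 1) u = G.view (d + e + 1) v := by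
    intro e
    induction e with
    | zero => exact h
    | succ e ih => exact step _ ih
  intro u v huv
  induction m with
  | zero => exact huv
  | succ m ih => exact all m u v ih

theorem numViews_lt_succ [NeZero n] (hG : G.Feasible) {d : ℕ} (hd : d < G.electionIndex) :
    G.numViews d < G.numViews (d + 1) := by
  refine lt_of_le_of_ne (numViews_le_succ G d) fun h => ?_
  have h1 := view_add_of_view G (d := d)
    (fun u v huv => view_succ_of_view_of_numViews_eq G h.symm huv) (G.electionIndex - d)
  rw [Nat.add_sub_cancel' hd.le] at h1
  have h2 : Function.Injective (G.view d) := fun u v huv =>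
    view_electionIndex_injective G hG (h1 u v huv)
  exact absurd (electionIndex_le_of_view_injective G h2) (not_le.2 hd)

/-- Each round before the election index increases the number of distinct views, which is at
most `n`. -/
theorem electionIndex_le [NeZero n] (hG : G.Feasible) : G.electionIndex ≤ n := by
  have h : ∀ d, d ≤ G.electionIndex → d ≤ G.numViews d := by
    intro d
    induction d with
    | zero => intro _; exact Nat.zero_le _
    | succ d ih =>
      intro hd
      have := ih (by omega)
      have := numViews_lt_succ G hG (d := d) (by omega)
      omega
  exact (h _ le_rfl).trans (numViews_le G _)

theorem deg_pos (hn : 2 ≤ n) (v : Fin n) : 0 < G.deg v := by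
  have : Nontrivial (Fin n) := Fin.nontrivial_iff_two_le.2 hn
  obtain ⟨w, hw⟩ := G.connected.preconnected.exists_adj_of_nontrivial v
  exact (G.port v ⟨w, hw⟩).pos

theorem deg_lt (v : Fin n) : G.deg v < n := by
  have h : Finset.univ.image (G.nbr v) ⊆ Finset.univ.erase v := by
    intro w hw
    obtain ⟨j, -, rfl⟩ := Finset.mem_image.1 hw
    exact Finset.mem_erase.2 ⟨(G.adj_nbr v j).ne', Finset.mem_univ _⟩
  have h1 := Finset.card_le_card h
  rw [Finset.card_image_of_injective _ (nbr_injective G v)] at h1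
  simp at h1
  have := v.pos
  omega

theorem farPort_lt (v : Fin n) (j : Fin (G.deg v)) : G.farPort v j < n :=
  (Fin.is_lt _).trans (deg_lt G _)

/-- Two nodes have the same degree, so that no election is possible without communication. -/
theorem electionIndex_pos (hn : 2 ≤ n) (hG : G.Feasible) : 0 < G.electionIndex := by
  rw [Nat.pos_iff_ne_zero]
  intro h0
  have h := view_electionIndex_injective G hG
  rw [h0] at h
  replace h : Function.Injective G.deg := h
  have h1 : Finset.univ.image G.deg ⊆ Finset.Ioo 0 n := by
    intro x hx
    obtain ⟨v, -, rfl⟩ := Finset.mem_image.1 hx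
    exact Finset.mem_Ioo.2 ⟨deg_pos G hn v, deg_lt G v⟩
  have h2 := Finset.card_le_card h1
  rw [Finset.card_image_of_injective _ h] at h2
  simp at h2
  omega

end PortGraph

/-! ### Sets of views as lists -/

theorem mem_viewSet {d : ℕ} {l : List (AView d)} {B : AView d} : B ∈ viewSet l ↔ B ∈ l := by
  simp [viewSet, List.mem_insertionSort]

theorem nodup_viewSet {d : ℕ} (l : List (AView d)) : (viewSet l).Nodup :=
  (List.perm_insertionSort _ _).nodup_iff.2 (List.nodup_dedup l)

namespace PortGraph

theorem mem_views {d : ℕ} {B : AView d} : B ∈ G.views d ↔ ∃ v, G.view d v = B := by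
  simp [views, mem_viewSet]

theorem mem_viewsOver {d : ℕ} {B : AView d} {B' : AView (d + 1)} :
    B' ∈ G.viewsOver B ↔ ∃ v, G.view d v = B ∧ G.view (d + 1) v = B' := by
  simp [viewsOver, mem_viewSet]

theorem nodup_views (d : ℕ) : (G.views d).Nodup := nodup_viewSet _

theorem nodup_viewsOver {d : ℕ} (B : AView d) : (G.viewsOver B).Nodup := nodup_viewSet _

theorem toFinset_views (d : ℕ) : (G.views d).toFinset = Finset.univ.image (G.view d) := by
  ext B
  simp [mem_views]

theorem length_views (d : ℕ) : (G.views d).length = G.numViews d := by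
  rw [numViews, ← toFinset_views, List.toFinset_card_of_nodup (nodup_views G d)]

theorem viewsOver_ne_nil {d : ℕ} (v : Fin n) : G.viewsOver (G.view d v) ≠ [] :=
  List.ne_nil_of_mem ((mem_viewsOver G).2 ⟨v, rfl, rfl⟩)

theorem toFinset_viewsOver {d : ℕ} (B : AView d) :
    (G.viewsOver B).toFinset =
      (Finset.univ.image (G.view (d + 1))).filter fun B' => B'.trunc = B := by
  ext B'
  simp only [List.mem_toFinset, mem_viewsOver, Finset.mem_filter, Finset.mem_image,
    Finset.mem_univ, true_and]
  constructor
  · rintro ⟨v, rfl, rfl⟩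
    exact ⟨⟨v, rfl⟩, trunc_view G d v⟩
  · rintro ⟨⟨v, rfl⟩, h⟩
    exact ⟨v, (trunc_view G d v).symm.trans h, rfl⟩

theorem sum_length_viewsOver (d : ℕ) :
    ∑ B ∈ Finset.univ.image (G.view d), (G.viewsOver B).length = G.numViews (d + 1) := by
  have h := Finset.card_eq_sum_card_fiberwise (f := AView.trunc (d := d))
    (s := Finset.univ.image (G.view (d + 1))) (t := Finset.univ.image (G.view d)) (by
      intro B hB
      rw [← image_trunc_views]
      exact Finset.mem_coe.2 (Finset.mem_image_of_mem _ hB))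
  rw [numViews, h]
  refine Finset.sum_congr rfl fun B _ => ?_
  rw [← toFinset_viewsOver, List.toFinset_card_of_nodup (nodup_viewsOver G B)]

end PortGraph

end Views

/-! ### Tries built from sets of views -/

section Tries

variable {d : ℕ}

/-- The answer of the view `B`, with the list `X` of the labels of its children, to the query `q`:
whether `LocalLabel` goes to the left subtrie. It is `none` if the query concerns a port that does
not exist. -/
def goesLeft (B : AView d) (X : List ℕ) (q : ℕ × ℕ) : Option Bool :=
  if X = [] then
    some (decide ((q.1 = 0 ∧ B.code.length < q.2) ∨ (q.1 = 1 ∧ nthBit B.code q.2 = some false)))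
  else
    (X[q.1]?).map fun z => decide (z ≠ q.2)

theorem localLabel_node (B : AView d) (X : List ℕ) (q : ℕ × ℕ) (l r : Trie) :
    localLabel B X (.node q l r) = (goesLeft B X q).bind fun left =>
      if left then localLabel B X l else (localLabel B X r).map fun y => l.numLeaves + y := by
  rcases q with ⟨x, y⟩
  rw [localLabel, goesLeft]
  simp only [Option.bind_eq_bind, Option.pure_def, Option.map_eq_bind, Function.comp_def]
  split_ifs <;> rfl

/-- The trie `T` separates the elements of `S` from each other: each query splits the views that
reach it, which never happens to be a single one, and exactly one view reaches each leaf. -/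
def Separates (X : AView d → List ℕ) : List (AView d) → Trie → Prop
  | S, .leaf => S.length = 1
  | S, .node q l r => ∃ p : AView d → Bool, (∀ B ∈ S, goesLeft B (X B) q = some (p B)) ∧
      Separates X (S.filter p) l ∧ Separates X (S.filter fun B => !p B) r

theorem length_filter_add_length_filter_not {α : Type} (p : α → Bool) (S : List α) :
    (S.filter p).length + (S.filter fun B => !p B).length = S.length := by
  have h := List.length_eq_length_filter_add (l := S) p
  exact h.symm

theorem Separates.numLeaves_eq {X : AView d → List ℕ} {T : Trie} :
    ∀ {S : List (AView d)}, Separates X S T → T.numLeaves = S.length := by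
  induction T with
  | leaf => intro S h; exact h.symm
  | node q l r ihl ihr =>
    rintro S ⟨p, -, hl, hr⟩
    rw [Trie.numLeaves, ihl hl, ihr hr, length_filter_add_length_filter_not]

/-- `LocalLabel` with a trie that separates `S` numbers the elements of `S` by `1, …, |S|`. -/
theorem Separates.exists_localLabel {X : AView d → List ℕ} {T : Trie} :
    ∀ {S : List (AView d)}, Separates X S T → ∃ g : AView d → ℕ,
      (∀ B ∈ S, localLabel B (X B) T = some (g B) ∧ 1 ≤ g B ∧ g B ≤ S.length) ∧
      ∀ B ∈ S, ∀ B' ∈ S, g B = g B' → B = B' := by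
  induction T with
  | leaf =>
    intro S h
    obtain ⟨B, rfl⟩ := List.length_eq_one_iff.1 h
    refine ⟨fun _ => 1, ?_, ?_⟩
    · intro B' _
      exact ⟨rfl, le_rfl, le_rfl⟩
    · intro B₁ h₁ B₂ h₂ _
      rw [List.mem_singleton.1 h₁, List.mem_singleton.1 h₂]
  | node q l r ihl ihr =>
    rintro S ⟨p, hp, hl, hr⟩
    obtain ⟨gl, hgl, hgl'⟩ := ihl hl
    obtain ⟨gr, hgr, hgr'⟩ := ihr hr
    have hlen := length_filter_add_length_filter_not p S
    have hln := hl.numLeaves_eq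
    refine ⟨fun B => if p B then gl B else l.numLeaves + gr B, ?_, ?_⟩
    · intro B hB
      rw [localLabel_node, hp B hB, Option.bind_some]
      by_cases h : p B = true
      · have := hgl B (by simp [hB, h])
        simp only [h, if_true]
        exact ⟨this.1, this.2.1, by omega⟩
      · have := hgr B (by simp [hB, h])
        simp only [h, this.1]
        exact ⟨rfl, by simp; omega, by simp; omega⟩
    · intro B hB B' hB' h
      by_cases h1 : p B = true <;> by_cases h2 : p B' = true <;>
        simp only [h1, h2, if_true, if_false, Bool.false_eq_true] at h
      · exact hgl' B (by simp [hB, h1]) B' (by simp [hB', h2]) h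
      · have e1 := hgl B (by simp [hB, h1])
        have e2 := hgr B' (by simp [hB', h2])
        omega
      · have e1 := hgl B' (by simp [hB', h2])
        have e2 := hgr B (by simp [hB, h1])
        omega
      · exact hgr' B (by simp [hB, h1]) B' (by simp [hB', h2]) (by omega)

/-- The query put at the root of `BuildTrie(S, E₁, E₂)`, and the characteristic function of the
set of views going to the left subtrie. -/
def rootQuery (S : List (AView (d + 1))) (E₁ : Option Trie) (E₂ : NestedList) :
    Option ((ℕ × ℕ) × (AView (d + 1) → Bool)) :=
  match E₁ with
  | none =>
    let max := (S.map fun B => B.code.length).foldr Nat.max 0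
    if ∃ B ∈ S, ∃ B' ∈ S, B.code.length ≠ B'.code.length then
      some ((0, max), fun B => decide (B.code.length < max))
    else do
      let j ← (List.range' 1 max).find? fun j =>
        decide (∃ B ∈ S, ∃ B' ∈ S, nthBit B.code j ≠ nthBit B'.code j)
      return ((1, j), fun B => decide (nthBit B.code j = some false))
  | some E => do
    let (i, Bdisc) ← discriminate S
    let y ← retrieveLabel E E₂ Bdisc
    return ((i, y), fun B => decide (B.child i ≠ some Bdisc))

theorem buildTrie_succ (k : ℕ) (S : List (AView (d + 1))) (E₁ : Option Trie) (E₂ : NestedList) :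
    buildTrie (k + 1) S E₁ E₂ = if S.length = 1 then some .leaf else
      (rootQuery S E₁ E₂).bind fun q =>
        (buildTrie k (S.filter q.2) E₁ E₂).bind fun l =>
          (buildTrie k (S.filter fun B => !q.2 B) E₁ E₂).bind fun r => some (.node q.1 l r) := by
  conv_lhs => unfold buildTrie
  rfl

/-- `BuildTrie` succeeds on a set of views, with a trie that separates this set, as soon as each
query splits into two non-empty parts the set it is chosen for. The depth of the recursion is at
most the size of the set. -/
theorem exists_buildTrie {S₀ : List (AView (d + 1))} {E₁ : Option Trie} {E₂ : NestedList}
    {X : AView (d + 1) → List ℕ} {P : ℕ × ℕ → Prop}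
    (hsplit : ∀ S, S.Sublist S₀ → 2 ≤ S.length → ∃ q p, rootQuery S E₁ E₂ = some (q, p) ∧ P q ∧
      (∀ B ∈ S, goesLeft B (X B) q = some (p B)) ∧
      (∃ B ∈ S, p B = true) ∧ ∃ B ∈ S, p B = false) :
    ∀ (m : ℕ) (S : List (AView (d + 1))), S.length ≤ m → S.Sublist S₀ → S ≠ [] →
      ∃ T, (∀ k ≥ S.length, buildTrie k S E₁ E₂ = some T) ∧ Separates X S T ∧
        T.AllQueries P := by
  intro m
  induction m with
  | zero =>
    intro S hm _ hS
    exact absurd (List.length_eq_zero_iff.1 (by omega)) hS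
  | succ m ih =>
    intro S hm hsub hS
    by_cases h1 : S.length = 1
    · refine ⟨.leaf, fun k hk => ?_, h1, trivial⟩
      obtain ⟨k, rfl⟩ := Nat.exists_eq_add_one_of_ne_zero (show k ≠ 0 by omega)
      rw [buildTrie_succ, if_pos h1]
    · have h0 := List.length_pos_of_ne_nil hS
      obtain ⟨q, p, hq, hP, hgo, ⟨B, hB, hpB⟩, ⟨B', hB', hpB'⟩⟩ := hsplit S hsub (by omega)
      have hlen := length_filter_add_length_filter_not p S
      have hl : S.filter p ≠ [] := List.ne_nil_of_mem (by simpa using ⟨hB, hpB⟩)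
      have hr : S.filter (fun B => !p B) ≠ [] :=
        List.ne_nil_of_mem (a := B') (by simpa using ⟨hB', hpB'⟩)
      have hl0 := List.length_pos_of_ne_nil hl
      have hr0 := List.length_pos_of_ne_nil hr
      obtain ⟨l, hl1, hl2, hl3⟩ := ih _ (by omega) (List.filter_sublist.trans hsub) hl
      obtain ⟨r, hr1, hr2, hr3⟩ := ih _ (by omega) (List.filter_sublist.trans hsub) hr
      refine ⟨.node q l r, fun k hk => ?_, ⟨p, hgo, hl2, hr2⟩, hP, hl3, hr3⟩
      obtain ⟨k, rfl⟩ := Nat.exists_eq_add_one_of_ne_zero (show k ≠ 0 by omega)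
      rw [buildTrie_succ, if_neg h1, hq, Option.bind_some, hl1 k (by omega), Option.bind_some,
        hr1 k (by omega), Option.bind_some]

theorem le_foldr_max {l : List ℕ} {x : ℕ} (h : x ∈ l) : x ≤ l.foldr Nat.max 0 := by
  induction l with
  | nil => simp at h
  | cons a l ih =>
    rw [List.foldr_cons]
    rcases List.mem_cons.1 h with rfl | h
    · exact Nat.le_max_left _ _
    · exact (ih h).trans (Nat.le_max_right _ _)

theorem foldr_max_mem {l : List ℕ} (h : l ≠ []) : l.foldr Nat.max 0 ∈ l := by
  induction l with
  | nil => exact absurd rfl h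
  | cons a l ih =>
    rw [List.foldr_cons]
    by_cases hl : l = []
    · subst hl; simp
    · have := ih hl
      rcases Nat.le_total a (l.foldr Nat.max 0) with h | h
      · rw [show Nat.max a (l.foldr Nat.max 0) = l.foldr Nat.max 0 from Nat.max_eq_right h]
        exact List.mem_cons_of_mem _ this
      · rw [show Nat.max a (l.foldr Nat.max 0) = a from Nat.max_eq_left h]
        exact List.mem_cons_self

theorem nthBit_of_le {s : Bits} {j : ℕ} (hj : 1 ≤ j) (h : j ≤ s.length) :
    ∃ b, nthBit s j = some b := by
  obtain ⟨j, rfl⟩ := Nat.exists_eq_add_of_le' hj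
  exact ⟨s[j], List.getElem?_eq_getElem (by omega)⟩

/-- The queries of the trie for views of depth `1` split every set of views with distinct
codes. -/
theorem rootQuery_none {S₀ : List (AView (d + 1))} (hnd : S₀.Nodup)
    (hcode : ∀ B ∈ S₀, ∀ B' ∈ S₀, B.code = B'.code → B = B') {M : ℕ}
    (hM : ∀ B ∈ S₀, B.code.length ≤ M) (S : List (AView (d + 1))) (hS : S.Sublist S₀)
    (h2 : 2 ≤ S.length) :
    ∃ q p, rootQuery S none [] = some (q, p) ∧ (q.1 ≤ 1 ∧ q.2 ≤ M) ∧
      (∀ B ∈ S, goesLeft B [] q = some (p B)) ∧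
      (∃ B ∈ S, p B = true) ∧ ∃ B ∈ S, p B = false := by
  have hne : S.map (fun B => B.code.length) ≠ [] := by
    intro h
    rw [List.map_eq_nil_iff] at h
    simp [h] at h2
  obtain ⟨B₀, hB₀, hmax⟩ := List.mem_map.1 (foldr_max_mem hne)
  have hle : ∀ B ∈ S, B.code.length ≤ (S.map fun B => B.code.length).foldr Nat.max 0 :=
    fun B hB => le_foldr_max (List.mem_map.2 ⟨B, hB, rfl⟩)
  simp only [rootQuery]
  generalize (S.map fun B => B.code.length).foldr Nat.max 0 = m at hmax hle
  have hm : m ≤ M := hmax ▸ hM B₀ (hS.subset hB₀)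
  split_ifs with hdiff
  · refine ⟨(0, m), _, rfl, ⟨Nat.zero_le _, hm⟩, ?_, ?_, ?_⟩
    · intro B _
      simp [goesLeft]
    · obtain ⟨B, hB, B', hB', h⟩ := hdiff
      have h1 := hle B hB
      have h2 := hle B' hB'
      rcases Nat.lt_or_ge B.code.length m with h3 | h3
      · exact ⟨B, hB, by simpa using h3⟩
      · exact ⟨B', hB', by simp; omega⟩
    · exact ⟨B₀, hB₀, by simp; omega⟩
  · push Not at hdiff
    have hlen : ∀ B ∈ S, B.code.length = m := fun B hB => (hdiff B hB B₀ hB₀).trans hmax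
    have hj : ∃ j, (List.range' 1 m).find? (fun j =>
        decide (∃ B ∈ S, ∃ B' ∈ S, nthBit B.code j ≠ nthBit B'.code j)) = some j := by
      rw [← Option.isSome_iff_exists, List.find?_isSome]
      have hBB : ∃ B ∈ S, ∃ B' ∈ S, B ≠ B' := by
        refine ⟨S[0], List.getElem_mem _, S[1], List.getElem_mem _, fun h => ?_⟩
        have := (hS.nodup hnd).getElem_inj_iff.1 h
        omega
      obtain ⟨B, hB, B', hB', hBB'⟩ := hBB
      by_contra hcon
      push Not at hcon
      refine hBB' (hcode B (hS.subset hB) B' (hS.subset hB') ?_)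
      refine List.ext_getElem? fun j => ?_
      by_cases hjm : j < m
      · have := hcon (j + 1) (by simp; omega)
        by_contra hne
        exact this (decide_eq_true ⟨B, hB, B', hB', hne⟩)
      · rw [List.getElem?_eq_none (by rw [hlen B hB]; omega),
          List.getElem?_eq_none (by rw [hlen B' hB']; omega)]
    obtain ⟨j, hj⟩ := hj
    have hjm := List.mem_of_find?_eq_some hj
    have hjs := List.find?_some hj
    simp only [List.mem_range'_1] at hjm
    rw [decide_eq_true_eq] at hjs
    rw [hj]
    refine ⟨(1, j), _, rfl, ⟨le_rfl, by omega⟩, ?_, ?_⟩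
    · intro B _
      simp [goesLeft]
    · obtain ⟨B, hB, B', hB', h⟩ := hjs
      obtain ⟨b, hb⟩ := nthBit_of_le (s := B.code) (j := j) (by omega) (by rw [hlen B hB]; omega)
      obtain ⟨b', hb'⟩ :=
        nthBit_of_le (s := B'.code) (j := j) (by omega) (by rw [hlen B' hB']; omega)
      rw [hb, hb'] at h
      cases b <;> cases b'
      · exact absurd rfl h
      · exact ⟨⟨B, hB, by simp [hb]⟩, ⟨B', hB', by simp [hb']⟩⟩
      · exact ⟨⟨B', hB', by simp [hb']⟩, ⟨B, hB, by simp [hb]⟩⟩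
      · exact absurd rfl h

end Tries

/-! ### Codes of views at depth one -/

section ViewCodes

/-- The list of strings whose `concat` is the code of a view at depth `1`. -/
def childCodes (l : List (ℕ × ℕ)) : List Bits :=
  l.mapIdx fun j c => concat [bin j, bin c.1, bin c.2]

theorem childCodes_ne (l : List (ℕ × ℕ)) : childCodes l ≠ [[]] := by
  refine ne_singleton_nil_of_forall fun a ha => ?_
  obtain ⟨j, hj, rfl⟩ := List.mem_mapIdx.1 ha
  intro h
  have := concat_eq_nil (by simp) h
  simp at this

theorem childCodes_injective : Function.Injective childCodes := by
  intro l l' h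
  refine List.ext_getElem? fun j => ?_
  have h2 := congrArg (fun l : List Bits => l[j]?) h
  simp only [childCodes, List.getElem?_mapIdx] at h2
  have hinj : Function.Injective fun c : ℕ × ℕ => concat [bin j, bin c.1, bin c.2] := by
    intro c c' hc
    have h3 := concat_injOn (by simp) (by simp) hc
    simp only [List.cons.injEq, and_true, true_and] at h3
    have e1 := congrArg unbin h3.1
    have e2 := congrArg unbin h3.2
    rw [unbin_bin, unbin_bin] at e1 e2
    exact Prod.ext e1 e2
  exact Option.map_injective hinj h2

theorem code_one_injective : Function.Injective (AView.code (d := 1)) := fun B B' h =>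
  childCodes_injective (concat_injOn (childCodes_ne B) (childCodes_ne B') h)

theorem PortGraph.length_code_view_one_le {n : ℕ} (G : PortGraph n) {b : ℕ} (hb : 1 ≤ b)
    (hn : n ≤ 2 ^ b) (v : Fin n) : (G.view 1 v).code.length ≤ n * (12 * b + 14) := by
  have hlt : ∀ x < n, (bin x).length ≤ b := fun x hx => length_bin_le hb (hx.trans_le hn)
  have hcode : (G.view 1 v).code =
    concat (childCodes (List.ofFn fun j => (G.farPort v j, G.deg (G.nbr v j)))) := rfl
  rw [hcode]
  refine (length_concat_le_mul _ (c := 6 * b + 6) ?_).trans ?_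
  · intro a ha
    obtain ⟨j, hj, rfl⟩ := List.mem_mapIdx.1 ha
    refine (length_concat_le _).trans ?_
    have hjd : j < G.deg v := by simpa using hj
    have h1 := hlt j (hjd.trans (G.deg_lt v))
    have h2 := hlt _ (G.farPort_lt v ⟨j, hjd⟩)
    have h3 := hlt _ (G.deg_lt (G.nbr v ⟨j, hjd⟩))
    simp only [List.getElem_ofFn, List.map_cons, List.map_nil, List.sum_cons, List.sum_nil]
    omega
  · rw [childCodes, List.length_mapIdx, List.length_ofFn]
    refine Nat.mul_le_mul (G.deg_lt v).le ?_
    omega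

end ViewCodes

/-! ### Labels of views -/

theorem mapM_eq_some_map {α β : Type} {g : α → Option β} {h : α → β} {l : List α}
    (H : ∀ x ∈ l, g x = some (h x)) : l.mapM g = some (l.map h) := by
  induction l with
  | nil => rfl
  | cons a l ih =>
    simp [List.mapM_cons, H a (by simp), ih fun x hx => H x (by simp [hx])]

theorem retrieveLabel_add_two (E₁ : Trie) (E₂ : NestedList) {d : ℕ} (B : AView (d + 2)) :
    retrieveLabel E₁ E₂ B =
      (B.children.mapM fun B' => retrieveLabel E₁ E₂ (d := d + 1) B').bind fun X =>
        (retrieveLabel E₁ E₂ (d := d + 1) B.trunc).bind fun label =>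
          (List.lookup (d + 2) E₂).bind fun L => labelSum L label (localLabel B X) label := by
  conv_lhs => unfold retrieveLabel
  rfl

/-- `RetrieveLabel` on views of depth `d` only uses the entries of `E₂` for depths up to `d`. -/
theorem retrieveLabel_congr (E₁ : Trie) {E₂ E₂' : NestedList} : ∀ {d : ℕ},
    (∀ j ≤ d, List.lookup j E₂ = List.lookup j E₂') → ∀ B : AView d,
      retrieveLabel E₁ E₂ B = retrieveLabel E₁ E₂' B
  | 0, _, _ => rfl
  | 1, _, _ => rfl
  | d + 2, h, B => by
    have ih : ∀ B : AView (d + 1), retrieveLabel E₁ E₂ B = retrieveLabel E₁ E₂' B :=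
      retrieveLabel_congr E₁ fun j hj => h j (by omega)
    rw [retrieveLabel_add_two, retrieveLabel_add_two, h _ le_rfl, ih]
    simp only [ih]

/-- The contribution of the views whose truncation has label `i` to the sums computed by
`RetrieveLabel`: the number of these views. -/
def labelWeight (L : TrieList) (i : ℕ) : ℕ :=
  match List.lookup i L with
  | some T => T.numLeaves
  | none => 1

theorem labelSum_of_lt (L : TrieList) (label : ℕ) (loc : Trie → Option ℕ) :
    ∀ {j : ℕ}, j < label →
      labelSum L label loc j = some (∑ i ∈ Finset.range j, labelWeight L (i + 1))
  | 0, _ => rfl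
  | j + 1, h => by
    rw [Finset.sum_range_succ, labelSum, labelSum_of_lt L label loc (by omega)]
    simp only [labelWeight, Option.bind_eq_bind, Option.bind_some]
    cases List.lookup (j + 1) L with
    | none => rfl
    | some T => simp [h]

theorem labelSum_self {L : TrieList} {label : ℕ} (hl : 1 ≤ label) {loc : Trie → Option ℕ} {y : ℕ}
    (h : ∀ T, List.lookup label L = some T → loc T = some y)
    (h' : List.lookup label L = none → y = 1) :
    labelSum L label loc label =
      some (∑ i ∈ Finset.range (label - 1), labelWeight L (i + 1) + y) := by
  obtain ⟨j, rfl⟩ := Nat.exists_eq_add_of_le' hl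
  rw [labelSum, labelSum_of_lt L _ loc (Nat.lt_succ_self j)]
  simp only [Option.bind_eq_bind, Option.bind_some, Nat.add_sub_cancel]
  cases hT : List.lookup (j + 1) L with
  | none => simp [h' hT]
  | some T => simp [h T hT]

theorem lookup_map_of_injOn {α β : Type} [DecidableEq α] {f : α → ℕ} {t : α → β} (a : α)
    (l : List α) (hf : ∀ b ∈ l, f b = f a → b = a) :
    List.lookup (f a) (l.map fun b => (f b, t b)) = if a ∈ l then some (t a) else none := by
  induction l with
  | nil => rfl
  | cons b l ih =>
    have ih := ih fun c hc => hf c (by simp [hc])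
    rw [List.map_cons, List.lookup_cons]
    by_cases hab : a = b
    · subst hab
      simp
    · have hfab : f a ≠ f b := fun h => hab (hf b (by simp) h.symm).symm
      rw [beq_eq_false_iff_ne.2 hfab]
      simpa [hab] using ih

section Labels

variable {n : ℕ} (G : PortGraph n)

/-- `RetrieveLabel`, with `E₁` and `E₂`, numbers the augmented truncated views at depth `d` in `G`
by consecutive integers from `1`, through the function `f`. -/
structure IsLabeling (d : ℕ) (E₁ : Trie) (E₂ : NestedList) (f : AView d → ℕ) : Prop where
  retrieve : ∀ v, retrieveLabel E₁ E₂ (G.view d v) = some (f (G.view d v))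
  pos : ∀ v, 1 ≤ f (G.view d v)
  le : ∀ v, f (G.view d v) ≤ G.numViews d
  inj : ∀ u v, f (G.view d u) = f (G.view d v) → G.view d u = G.view d v

variable {G}

theorem IsLabeling.image_eq {d : ℕ} {E₁ : Trie} {E₂ : NestedList} {f : AView d → ℕ}
    (hf : IsLabeling G d E₁ E₂ f) :
    (Finset.univ.image (G.view d)).image f = Finset.Icc 1 (G.numViews d) := by
  refine Finset.eq_of_subset_of_card_le ?_ ?_
  · intro x hx
    simp only [Finset.mem_image, Finset.mem_univ, true_and] at hx
    obtain ⟨_, ⟨v, rfl⟩, rfl⟩ := hx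
    exact Finset.mem_Icc.2 ⟨hf.pos v, hf.le v⟩
  · rw [Finset.card_image_of_injOn, Nat.card_Icc, Nat.add_sub_cancel, PortGraph.numViews]
    intro B hB B' hB' h
    simp only [Finset.coe_image, Finset.coe_univ, Set.image_univ, Set.mem_range] at hB hB'
    obtain ⟨u, rfl⟩ := hB
    obtain ⟨v, rfl⟩ := hB'
    exact hf.inj u v h

theorem IsLabeling.sum_eq {d : ℕ} {E₁ : Trie} {E₂ : NestedList} {f : AView d → ℕ}
    (hf : IsLabeling G d E₁ E₂ f) (w : ℕ → ℕ) :
    ∑ i ∈ Finset.range (G.numViews d), w (i + 1) =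
      ∑ B ∈ Finset.univ.image (G.view d), w (f B) := by
  rw [← Finset.sum_image (f := w) (g := f) (s := Finset.univ.image (G.view d)), hf.image_eq,
    Finset.range_eq_Ico, Finset.sum_Ico_add' (fun i => w i) 0 (G.numViews d) 1]
  · rfl
  · intro B hB B' hB' h
    simp only [Finset.coe_image, Finset.coe_univ, Set.image_univ, Set.mem_range] at hB hB'
    obtain ⟨u, rfl⟩ := hB
    obtain ⟨v, rfl⟩ := hB'
    exact hf.inj u v h

variable (G) in
/-- The trie `E₁` computed by `ComputeAdvice` labels the views at depth `1`. -/
theorem exists_trie_one (hn : 1 ≤ n) {M : ℕ} (hM : ∀ v, (G.view 1 v).code.length ≤ M) :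
    ∃ E₁ : Trie, (∀ k ≥ n, buildTrie k (G.views 1) none [] = some E₁) ∧
      E₁.numLeaves = G.numViews 1 ∧ E₁.AllQueries (fun q => q.1 ≤ 1 ∧ q.2 ≤ M) ∧
      ∃ f, ∀ E₂, IsLabeling G 1 E₁ E₂ f := by
  have hne : G.views 1 ≠ [] := List.ne_nil_of_mem ((G.mem_views).2 ⟨⟨0, hn⟩, rfl⟩)
  obtain ⟨T, hT, hsep, hq⟩ := exists_buildTrie (S₀ := G.views 1) (X := fun _ => [])
    (rootQuery_none (G.nodup_views 1) (fun B _ B' _ h => code_one_injective h) (M := M) (by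
      intro B hB
      obtain ⟨v, rfl⟩ := G.mem_views.1 hB
      exact hM v)) _ (G.views 1) le_rfl (List.Sublist.refl _) hne
  have hlen := G.length_views 1
  obtain ⟨g, hg, hg'⟩ := hsep.exists_localLabel
  have hmem : ∀ v, G.view 1 v ∈ G.views 1 := fun v => G.mem_views.2 ⟨v, rfl⟩
  refine ⟨T, fun k hk => hT k ?_, hsep.numLeaves_eq.trans hlen, hq, g, fun E₂ =>
    ⟨fun v => (hg _ (hmem v)).1, fun v => (hg _ (hmem v)).2.1, fun v => ?_, fun u v h =>
      hg' _ (hmem u) _ (hmem v) h⟩⟩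
  · rw [hlen]
    exact (G.numViews_le 1).trans hk
  · rw [← hlen]
    exact (hg _ (hmem v)).2.2

theorem child_view (d : ℕ) (v : Fin n) (i : Fin (G.deg v)) :
    (G.view (d + 1) v).child i = some (G.view d (G.nbr v i)) := by
  rw [AView.child, G.children_view, List.getElem?_eq_getElem (by simp)]
  simp

theorem length_children_view (d : ℕ) (v : Fin n) :
    (G.view (d + 1) v).children.length = G.deg v := by
  rw [G.children_view, List.length_ofFn]

theorem map_fst_trunc {d : ℕ} (B : AView (d + 2)) :
    List.map Prod.fst B.trunc = List.map (Prod.fst (α := ℕ) (β := AView (d + 1))) B := by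
  have key : ∀ l : List (ℕ × AView (d + 1)),
      List.map Prod.fst (l.map fun c => (c.1, c.2.trunc)) = l.map Prod.fst := by
    intro l
    rw [List.map_map]
    rfl
  exact key B

theorem ext_of_trunc_of_child {d : ℕ} {B B' : AView (d + 2)} (h : B.trunc = B'.trunc)
    (hc : ∀ i < B.children.length, B.child i = B'.child i) : B = B' := by
  have key : ∀ l l' : List (ℕ × AView (d + 1)), l.map Prod.fst = l'.map Prod.fst →
      (∀ i < (l.map Prod.snd).length, (l.map Prod.snd)[i]? = (l'.map Prod.snd)[i]?) → l = l' := by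
    intro l l' h1 h2
    have hl : l.length = l'.length := by simpa using congrArg List.length h1
    have h3 : l.map Prod.snd = l'.map Prod.snd := by
      refine List.ext_getElem? fun i => ?_
      by_cases hi : i < l.length
      · exact h2 i (by simpa using hi)
      · rw [List.getElem?_eq_none (by simp; omega), List.getElem?_eq_none (by simp; omega)]
    rw [List.zip_of_prod h1 h3]
    exact (List.zip_of_prod rfl rfl).symm
  refine key B B' ?_ hc
  rw [← map_fst_trunc, ← map_fst_trunc, h]

/-- Two distinct views with the same truncation are separated by the subview of one of them at
some child. This subview is recognized through its label. -/
theorem rootQuery_some {d : ℕ} {E₁ : Trie} {E₂ : NestedList} {f : AView (d + 1) → ℕ}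
    (hf : IsLabeling G (d + 1) E₁ E₂ f) (hn : 2 ≤ n) (B₀ : AView (d + 1))
    (S : List (AView (d + 2))) (hS : S.Sublist (G.viewsOver B₀)) (h2 : 2 ≤ S.length) :
    ∃ q p, rootQuery S (some E₁) E₂ = some (q, p) ∧ (q.1 < n ∧ q.2 ≤ n) ∧
      (∀ B ∈ S, goesLeft B (B.children.map f) q = some (p B)) ∧
      (∃ B ∈ S, p B = true) ∧ ∃ B ∈ S, p B = false := by
  have hmem : ∀ B ∈ S, ∃ v, G.view (d + 1) v = B₀ ∧ G.view (d + 2) v = B := fun B hB =>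
    G.mem_viewsOver.1 (hS.subset hB)
  obtain ⟨B, B', S', rfl⟩ : ∃ B B' S', S = B :: B' :: S' := by
    rcases S with _ | ⟨B, _ | ⟨B', S'⟩⟩
    · simp at h2
    · simp at h2
    · exact ⟨B, B', S', rfl⟩
  have hBB' : B ≠ B' := by
    have := hS.nodup (G.nodup_viewsOver B₀)
    simp only [List.nodup_cons, List.mem_cons, not_or] at this
    exact this.1.1
  obtain ⟨u, hu, rfl⟩ := hmem B (by simp)
  obtain ⟨u', hu', rfl⟩ := hmem B' (by simp)
  have hdeg : ∀ B ∈ (G.view (d + 2) u :: G.view (d + 2) u' :: S'), ∃ v, G.deg v = G.deg u ∧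
      G.view (d + 2) v = B := by
    intro B hB
    obtain ⟨v, hv, hv'⟩ := hmem B hB
    exact ⟨v, G.deg_of_view (hv.trans hu.symm), hv'⟩
  have hdu := G.deg_of_view (hu.trans hu'.symm)
  obtain ⟨i, hi⟩ : ∃ i, discIndex (G.view (d + 2) u) (G.view (d + 2) u') = some i := by
    rw [← Option.isSome_iff_exists, discIndex, List.find?_isSome]
    by_contra hcon
    refine hBB' (ext_of_trunc_of_child ?_ fun i hi => ?_)
    · rw [G.trunc_view, G.trunc_view, hu, hu']
    · by_contra hne
      exact hcon ⟨i, by simpa using hi, decide_eq_true hne⟩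
  have him := List.mem_of_find?_eq_some hi
  have his := List.find?_some hi
  rw [List.mem_range, length_children_view] at him
  have hchild : ∀ v, G.deg v = G.deg u →
      ∃ w, (G.view (d + 2) v).child i = some (G.view (d + 1) w) := by
    intro v hv
    exact ⟨_, child_view (d + 1) v ⟨i, by omega⟩⟩
  obtain ⟨w, hw⟩ := hchild u rfl
  obtain ⟨w', hw'⟩ := hchild u' hdu.symm
  have hww' : G.view (d + 1) w ≠ G.view (d + 1) w' := by
    intro h
    rw [decide_eq_true_eq, hw, hw', h] at his
    exact his rfl
  -- the discriminatory subview is one of the two subviews at port `i`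
  obtain ⟨x, hdisc, hx⟩ : ∃ x,
      discriminate (G.view (d + 2) u :: G.view (d + 2) u' :: S') = some (i, G.view (d + 1) x) ∧
      (G.view (d + 1) x = G.view (d + 1) w ∨ G.view (d + 1) x = G.view (d + 1) w') := by
    simp only [discriminate, hi, hw, hw', Option.bind_eq_bind, Option.bind_some, Option.pure_def]
    split_ifs
    · exact ⟨w, rfl, Or.inl rfl⟩
    · exact ⟨w', rfl, Or.inr rfl⟩
  refine ⟨(i, f (G.view (d + 1) x)), fun B => decide (B.child i ≠ some (G.view (d + 1) x)), ?_,
    ⟨him.trans (G.deg_lt u), (hf.le x).trans (G.numViews_le _)⟩, ?_, ?_⟩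
  · simp only [rootQuery, hdisc, hf.retrieve, Option.bind_eq_bind, Option.bind_some,
      Option.pure_def]
  · intro B hB
    obtain ⟨v, hv, rfl⟩ := hdeg B hB
    obtain ⟨y, hy⟩ := hchild v hv
    have hne : List.map f (G.view (d + 2) v).children ≠ [] := by
      intro h
      have h1 := length_children_view (G := G) (d + 1) v
      rw [List.map_eq_nil_iff.1 h, hv] at h1
      exact absurd h1.symm (G.deg_pos hn u).ne'
    have hget : (List.map f (G.view (d + 2) v).children)[i]? = some (f (G.view (d + 1) y)) := by
      rw [List.getElem?_map, ← AView.child, hy, Option.map_some]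
    simp only [goesLeft, if_neg hne, hget, hy, Option.map_some]
    congr 1
    rw [decide_eq_decide]
    refine not_congr ⟨fun h => ?_, fun h => ?_⟩
    · rw [hf.inj _ _ h]
    · rw [Option.some.inj h]
  · rcases hx with hx | hx
    · exact ⟨⟨_, List.mem_cons_of_mem _ List.mem_cons_self, by
        simp only [hw', hx, decide_eq_true_eq]; exact fun h => hww' (Option.some.inj h).symm⟩,
        ⟨_, List.mem_cons_self, by simp only [hw, hx]; simp⟩⟩
    · exact ⟨⟨_, List.mem_cons_self, by
        simp only [hw, hx, decide_eq_true_eq]; exact fun h => hww' (Option.some.inj h)⟩,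
        ⟨_, List.mem_cons_of_mem _ List.mem_cons_self, by simp only [hw', hx]; simp⟩⟩

theorem length_viewsOver_le {d : ℕ} (B : AView d) : (G.viewsOver B).length ≤ n := by
  rw [← List.toFinset_card_of_nodup (G.nodup_viewsOver B), G.toFinset_viewsOver]
  exact (Finset.card_filter_le _ _).trans (G.numViews_le (d + 1))

theorem exists_trie_succ {d : ℕ} {E₁ : Trie} {E₂ : NestedList} {f : AView (d + 1) → ℕ}
    (hf : IsLabeling G (d + 1) E₁ E₂ f) (hn : 2 ≤ n) (v : Fin n) :
    ∃ T, (∀ k ≥ n, buildTrie k (G.viewsOver (G.view (d + 1) v)) (some E₁) E₂ = some T) ∧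
      Separates (fun B => B.children.map f) (G.viewsOver (G.view (d + 1) v)) T ∧
      T.AllQueries (fun q => q.1 < n ∧ q.2 ≤ n) := by
  obtain ⟨T, hT, hsep, hq⟩ := exists_buildTrie (rootQuery_some hf hn (G.view (d + 1) v)) _ _
    le_rfl (List.Sublist.refl _) (G.viewsOver_ne_nil v)
  exact ⟨T, fun k hk => hT k ((length_viewsOver_le _).trans hk), hsep, hq⟩

theorem sum_filter_length_le {α : Type} (o : α → ℕ) (l : List α) (h : ∀ B ∈ l, 1 ≤ o B) :
    ((l.filter fun B => 1 < o B).map o).sum + 2 * l.length ≤ 2 * (l.map o).sum := by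
  induction l with
  | nil => simp
  | cons a l ih =>
    have h1 := ih fun B hB => h B (by simp [hB])
    have h2 := h a (by simp)
    by_cases h3 : 1 < o a <;> simp [h3] <;> omega

theorem sum_map_length_viewsOver (d : ℕ) :
    ((G.views d).map fun B => (G.viewsOver B).length).sum = G.numViews (d + 1) := by
  rw [← G.sum_length_viewsOver, ← G.toFinset_views, List.sum_toFinset _ (G.nodup_views d)]

/-- From a labeling of the views at depth `d + 1`, the list `L(d + 2)` computed by `ComputeAdvice`
makes a labeling of the views at depth `d + 2`: a view whose truncation has label `m` comes after
all the views whose truncations have labels less than `m`, and the trie paired with `m` numbers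
the views with the same truncation. -/
theorem exists_levelList {d : ℕ} {E₁ : Trie} {E₂ : NestedList} {f : AView (d + 1) → ℕ}
    (hf : IsLabeling G (d + 1) E₁ E₂ f) (hn : 2 ≤ n) (hkeys : ∀ c ∈ E₂, c.1 ≤ d + 1) :
    ∃ L : TrieList, (∀ k ≥ n, G.levelList k E₁ E₂ (d + 1) = some L) ∧
      (∃ f', IsLabeling G (d + 2) E₁ (E₂ ++ [(d + 2, L)]) f') ∧
      (L.map fun c => c.2.numLeaves).sum + 2 * G.numViews (d + 1) ≤ 2 * G.numViews (d + 2) ∧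
      ∀ c ∈ L, c.1 ≤ n ∧ c.2.AllQueries (fun q => q.1 < n ∧ q.2 ≤ n) := by
  have hex : ∀ B : AView (d + 1), ∃ T, B ∈ G.views (d + 1) →
      (∀ k ≥ n, buildTrie k (G.viewsOver B) (some E₁) E₂ = some T) ∧
      Separates (fun B => B.children.map f) (G.viewsOver B) T ∧
      T.AllQueries (fun q => q.1 < n ∧ q.2 ≤ n) := by
    intro B
    by_cases hB : B ∈ G.views (d + 1)
    · obtain ⟨v, rfl⟩ := G.mem_views.1 hB
      obtain ⟨T, hT⟩ := exists_trie_succ hf hn v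
      exact ⟨T, fun _ => hT⟩
    · exact ⟨.leaf, fun h => absurd h hB⟩
  choose T hT using hex
  have hmem : ∀ v, G.view (d + 1) v ∈ G.views (d + 1) := fun v => G.mem_views.2 ⟨v, rfl⟩
  have hfB : ∀ B ∈ G.views (d + 1), retrieveLabel E₁ E₂ B = some (f B) := by
    intro B hB
    obtain ⟨v, rfl⟩ := G.mem_views.1 hB
    exact hf.retrieve v
  have hoB : ∀ B ∈ G.views (d + 1), 1 ≤ (G.viewsOver B).length := by
    intro B hB
    obtain ⟨v, rfl⟩ := G.mem_views.1 hB
    exact List.length_pos_of_ne_nil (G.viewsOver_ne_nil v)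
  let Q := (G.views (d + 1)).filter fun B => 1 < (G.viewsOver B).length
  let L : TrieList := Q.map fun B => (f B, T B)
  have hQ : ∀ {B}, B ∈ Q ↔ B ∈ G.views (d + 1) ∧ 1 < (G.viewsOver B).length := by
    intro B
    simp [Q]
  have hlookup : ∀ v, List.lookup (f (G.view (d + 1) v)) L =
      if 1 < (G.viewsOver (G.view (d + 1) v)).length then some (T (G.view (d + 1) v))
      else none := by
    intro v
    have h := lookup_map_of_injOn (f := f) (t := T) (G.view (d + 1) v) Q (by
      intro B hB h
      obtain ⟨u, rfl⟩ := G.mem_views.1 (hQ.1 hB).1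
      exact hf.inj _ _ h)
    simpa only [hQ, hmem v, true_and] using h
  have hweight : ∀ v, labelWeight L (f (G.view (d + 1) v)) =
      (G.viewsOver (G.view (d + 1) v)).length := by
    intro v
    have h1 := hoB _ (hmem v)
    rw [labelWeight, hlookup]
    split_ifs with h
    · exact (hT _ (hmem v)).2.1.numLeaves_eq
    · simp only
      omega
  let W : ℕ → ℕ := fun m => ∑ i ∈ Finset.range m, labelWeight L (i + 1)
  have hWmono : Monotone W := fun a b hab =>
    Finset.sum_le_sum_of_subset (Finset.range_mono hab)
  have hWsucc : ∀ v, W (f (G.view (d + 1) v)) =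
      W (f (G.view (d + 1) v) - 1) + (G.viewsOver (G.view (d + 1) v)).length := by
    intro v
    have h1 := hf.pos v
    rw [← hweight v]
    obtain ⟨j, hj⟩ := Nat.exists_eq_add_of_le' h1
    rw [hj]
    exact Finset.sum_range_succ _ _
  have hWtop : W (G.numViews (d + 1)) = G.numViews (d + 2) := by
    rw [← G.sum_length_viewsOver (d + 1)]
    refine (hf.sum_eq (labelWeight L)).trans (Finset.sum_congr rfl fun B hB => ?_)
    obtain ⟨v, -, rfl⟩ := Finset.mem_image.1 hB
    exact hweight v
  -- the rank of a view among those with the same truncation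
  have hg : ∀ B : AView (d + 1), ∃ g : AView (d + 2) → ℕ, B ∈ G.views (d + 1) →
      (∀ B' ∈ G.viewsOver B, localLabel B' (B'.children.map f) (T B) = some (g B') ∧
        1 ≤ g B' ∧ g B' ≤ (G.viewsOver B).length) ∧
      ∀ B' ∈ G.viewsOver B, ∀ B'' ∈ G.viewsOver B, g B' = g B'' → B' = B'' := by
    intro B
    by_cases hB : B ∈ G.views (d + 1)
    · obtain ⟨g, hg⟩ := (hT B hB).2.1.exists_localLabel
      exact ⟨g, fun _ => hg⟩
    · exact ⟨fun _ => 0, fun h => absurd h hB⟩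
  choose g hg using hg
  have hover : ∀ v, G.view (d + 2) v ∈ G.viewsOver (G.view (d + 1) v) := fun v =>
    G.mem_viewsOver.2 ⟨v, rfl, rfl⟩
  have hlook2 : List.lookup (d + 2) (E₂ ++ [(d + 2, L)]) = some L := by
    have : List.lookup (d + 2) E₂ = none := by
      rw [List.lookup_eq_none_iff]
      intro c hc
      have := hkeys c hc
      simp
      omega
    rw [List.lookup_append, this]
    simp
  have hret : ∀ B : AView (d + 1),
      retrieveLabel E₁ (E₂ ++ [(d + 2, L)]) B = retrieveLabel E₁ E₂ B := by
    refine retrieveLabel_congr E₁ fun j hj => ?_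
    rw [List.lookup_append]
    have : List.lookup j [(d + 2, L)] = none := by
      rw [List.lookup_eq_none_iff]
      simp
      omega
    rw [this, Option.or_none]
  refine ⟨L, fun k hk => ?_, ⟨fun B' => W (f B'.trunc - 1) + g B'.trunc B', ?_, ?_, ?_, ?_⟩, ?_,
    ?_⟩
  · refine mapM_eq_some_map fun B hB => ?_
    have hB' := (hQ.1 hB).1
    simp [hfB B hB', (hT B hB').1 k hk]
  · intro v
    have hX : (G.view (d + 2) v).children.mapM
        (fun B' => retrieveLabel E₁ (E₂ ++ [(d + 2, L)]) (d := d + 1) B') =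
        some ((G.view (d + 2) v).children.map f) := by
      refine mapM_eq_some_map fun B hB => ?_
      rw [G.children_view, List.mem_ofFn] at hB
      obtain ⟨j, rfl⟩ := hB
      rw [hret, hf.retrieve]
    have hgv := (hg _ (hmem v)).1 _ (hover v)
    rw [retrieveLabel_add_two, hX, Option.bind_some, G.trunc_view, hret, hf.retrieve,
      Option.bind_some, hlook2, Option.bind_some]
    refine labelSum_self (hf.pos v) ?_ ?_
    · intro T' hT'
      rw [hlookup] at hT'
      split_ifs at hT'
      rw [← Option.some.inj hT']
      exact hgv.1
    · intro hT'
      rw [hlookup] at hT'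
      split_ifs at hT'
      omega
  · intro v
    rw [G.trunc_view]
    have := ((hg _ (hmem v)).1 _ (hover v)).2.1
    omega
  · intro v
    rw [G.trunc_view, ← hWtop]
    have h1 := ((hg _ (hmem v)).1 _ (hover v)).2.2
    have h2 := hWsucc v
    have h3 := hWmono (hf.le v)
    omega
  · intro u v h
    rw [G.trunc_view, G.trunc_view] at h
    have hu := ((hg _ (hmem u)).1 _ (hover u)).2
    have hv := ((hg _ (hmem v)).1 _ (hover v)).2
    have hu2 := hWsucc u
    have hv2 := hWsucc v
    have huv : f (G.view (d + 1) u) = f (G.view (d + 1) v) := by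
      rcases lt_trichotomy (f (G.view (d + 1) u)) (f (G.view (d + 1) v)) with h1 | h1 | h1
      · have := hWmono (Nat.le_sub_one_of_lt h1)
        omega
      · exact h1
      · have := hWmono (Nat.le_sub_one_of_lt h1)
        omega
    have huv' := hf.inj u v huv
    rw [huv'] at h
    have hou := hover u
    rw [huv'] at hou
    exact (hg _ (hmem v)).2 _ hou _ (hover v) (by omega)
  · have h1 := sum_filter_length_le (fun B => (G.viewsOver B).length) (G.views (d + 1)) hoB
    rw [sum_map_length_viewsOver, G.length_views] at h1
    have h2 : (L.map fun c => c.2.numLeaves) = Q.map fun B => (G.viewsOver B).length := by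
      rw [List.map_map]
      refine List.map_congr_left fun B hB => ?_
      exact (hT B (hQ.1 hB).1).2.1.numLeaves_eq
    rw [h2]
    exact h1
  · intro c hc
    obtain ⟨B, hB, rfl⟩ := List.mem_map.1 hc
    have hB' := (hQ.1 hB).1
    refine ⟨?_, (hT B hB').2.2⟩
    obtain ⟨v, rfl⟩ := G.mem_views.1 hB'
    exact (hf.le v).trans (G.numViews_le _)

/-- The total number of leaves of the tries of a nested list. -/
def leafCount (E₂ : NestedList) : ℕ :=
  (E₂.map fun c => (c.2.map fun c => c.2.numLeaves).sum).sum

/-- The nested list computed by `ComputeAdvice` labels the views at depth `d + 1`. Its tries have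
`O(n)` leaves in total, as each of their internal nodes separates two classes of views. -/
theorem exists_nestedList {E₁ : Trie} (hn : 2 ≤ n) (hE₁ : ∃ f, IsLabeling G 1 E₁ [] f) (d : ℕ) :
    ∃ E₂ : NestedList, (∀ k ≥ n, G.nestedList k E₁ (d + 1) = some E₂) ∧
      (∃ f, IsLabeling G (d + 1) E₁ E₂ f) ∧ E₂.length = d ∧
      leafCount E₂ + 2 * G.numViews 1 ≤ 2 * G.numViews (d + 1) ∧
      ∀ c ∈ E₂, c.1 ≤ d + 1 ∧
        ∀ c' ∈ c.2, c'.1 ≤ n ∧ c'.2.AllQueries (fun q => q.1 < n ∧ q.2 ≤ n) := by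
  induction d with
  | zero => exact ⟨[], fun _ _ => rfl, hE₁, rfl, by simp [leafCount], by simp⟩
  | succ d ih =>
    obtain ⟨E₂, hE₂, ⟨f, hf⟩, hlen, hcount, hb⟩ := ih
    obtain ⟨L, hL, hf', hcount', hb'⟩ := exists_levelList hf hn fun c hc => (hb c hc).1
    refine ⟨E₂ ++ [(d + 2, L)], fun k hk => ?_, hf', by simp [hlen], ?_, ?_⟩
    · simp [PortGraph.nestedList, hE₂ k hk, hL k hk]
    · simp only [leafCount, List.map_append, List.map_cons, List.map_nil, List.sum_append,
        List.sum_cons, List.sum_nil, add_zero] at hcount ⊢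
      change _ ≤ 2 * G.numViews (d + 2)
      omega
    · intro c hc
      rcases List.mem_append.1 hc with hc | hc
      · exact ⟨(hb c hc).1.trans (Nat.le_succ _), (hb c hc).2⟩
      · rw [List.mem_singleton.1 hc]
        exact ⟨le_rfl, hb'⟩

end Labels

/-! ### The canonical BFS tree -/

theorem PForest.exists_pathUp {x : ℕ} {F : PForest ℕ} (h : x ∈ F.labels) :
    ∃ l, F.pathUp x = some l := by
  induction F with
  | nil => simp [labels] at h
  | cons p q y c rest ihc ihr =>
    by_cases hy : y = x
    · exact ⟨[q, p], by simp [pathUp, hy]⟩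
    · simp only [pathUp, hy, if_false]
      cases hc : c.pathUp x with
      | some l => exact ⟨l ++ [q, p], rfl⟩
      | none =>
        refine ihr ?_
        simp only [labels, List.mem_cons, List.mem_append] at h
        rcases h with h | h | h
        · exact absurd h.symm hy
        · obtain ⟨l, hl⟩ := ihc h
          rw [hc] at hl
          cases hl
        · exact h

namespace PortGraph

variable {n : ℕ} (G : PortGraph n) (r : Fin n)

theorem bfsParent_eq_some {u w : Fin n} (h : G.bfsParent r u = some w) :
    G.graph.Adj u w ∧ G.graph.dist r w + 1 = G.graph.dist r u := by
  rw [bfsParent, Option.map_eq_some_iff] at h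
  obtain ⟨j, hj, rfl⟩ := h
  have h := List.find?_some hj
  exact ⟨G.adj_nbr u j, of_decide_eq_true h⟩

theorem exists_bfsParent {u : Fin n} (hu : u ≠ r) : ∃ w, G.bfsParent r u = some w := by
  suffices h : ∃ j, G.graph.dist r (G.nbr u j) + 1 = G.graph.dist r u by
    obtain ⟨j, hj⟩ := h
    have : ((List.finRange (G.deg u)).find? fun j =>
        G.graph.dist r (G.nbr u j) + 1 = G.graph.dist r u).isSome := by
      rw [List.find?_isSome]
      exact ⟨j, List.mem_finRange j, decide_eq_true hj⟩
    obtain ⟨i, hi⟩ := Option.isSome_iff_exists.1 this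
    exact ⟨G.nbr u i, by rw [bfsParent, hi, Option.map_some]⟩
  obtain ⟨p, hp⟩ := G.connected.exists_walk_length_eq_dist u r
  cases p with
  | nil => exact absurd rfl hu
  | cons h p =>
    refine ⟨G.port u ⟨_, h⟩, ?_⟩
    rw [nbr_port]
    have h1 := SimpleGraph.dist_le p
    have h2 := G.connected.dist_triangle (u := u) (v := _) (w := r) |>.trans_eq
      (congrArg (· + _) (SimpleGraph.dist_eq_one_iff_adj.2 h))
    rw [SimpleGraph.Walk.length_cons] at hp
    rw [SimpleGraph.dist_comm, SimpleGraph.dist_comm (u := r) (v := u)]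
    omega

theorem mem_bfsChildPorts {u : Fin n} {j : Fin (G.deg u)} :
    j ∈ G.bfsChildPorts r u ↔ G.bfsParent r (G.nbr u j) = some u := by
  simp [bfsChildPorts]

theorem dist_nbr_of_mem_bfsChildPorts {u : Fin n} {j : Fin (G.deg u)}
    (h : j ∈ G.bfsChildPorts r u) : G.graph.dist r (G.nbr u j) = G.graph.dist r u + 1 :=
  (G.bfsParent_eq_some r ((G.mem_bfsChildPorts r).1 h)).2.symm

theorem bfsForest_succ (lab : Fin n → α) (m : ℕ) (u : Fin n) :
    G.bfsForest r lab (m + 1) u = (G.bfsChildPorts r u).foldr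
      (fun j rest => .cons j.val (G.farPort u j) (lab (G.nbr u j))
        (G.bfsForest r lab m (G.nbr u j)) rest) .nil := rfl

theorem labels_foldr {ι : Type} (js : List ι) (p q : ι → ℕ) (x : ι → α) (c : ι → PForest α) :
    (js.foldr (fun j rest => PForest.cons (p j) (q j) (x j) (c j) rest) .nil).labels =
      js.flatMap fun j => x j :: (c j).labels := by
  induction js with
  | nil => rfl
  | cons j js ih => simp [PForest.labels, ih]

theorem labels_bfsForest_succ (lab : Fin n → α) (m : ℕ) (u : Fin n) :
    (G.bfsForest r lab (m + 1) u).labels = (G.bfsChildPorts r u).flatMap fun j =>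
      lab (G.nbr u j) :: (G.bfsForest r lab m (G.nbr u j)).labels := by
  rw [bfsForest_succ, labels_foldr]

theorem labels_bfsForest (lab : Fin n → α) (m : ℕ) (u : Fin n) :
    (G.bfsForest r lab m u).labels = (G.bfsForest r id m u).labels.map lab := by
  induction m generalizing u with
  | zero => rfl
  | succ m ih =>
    rw [labels_bfsForest_succ, labels_bfsForest_succ, List.map_flatMap]
    simp only [List.map_cons, ih, id]

/-- The parent of a node in the canonical BFS tree; the root is its own parent. -/
noncomputable def bfsUp (u : Fin n) : Fin n := (G.bfsParent r u).getD u

theorem bfsUp_nbr {u : Fin n} {j : Fin (G.deg u)} (h : j ∈ G.bfsChildPorts r u) :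
    G.bfsUp r (G.nbr u j) = u := by
  rw [bfsUp, (G.mem_bfsChildPorts r).1 h, Option.getD_some]

/-- A node in the subtree below `u` is deeper than `u` and has `u` as an ancestor. -/
theorem ancestor_of_mem_labels {m : ℕ} {u w : Fin n} (h : w ∈ (G.bfsForest r id m u).labels) :
    G.graph.dist r u < G.graph.dist r w ∧
      (G.bfsUp r)^[G.graph.dist r w - G.graph.dist r u] w = u := by
  induction m generalizing u with
  | zero => simp [bfsForest, PForest.labels] at h
  | succ m ih =>
    rw [labels_bfsForest_succ, List.mem_flatMap] at h
    obtain ⟨j, hj, h⟩ := h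
    have hd := G.dist_nbr_of_mem_bfsChildPorts r hj
    have hup := G.bfsUp_nbr r hj
    rcases List.mem_cons.1 h with rfl | h
    · simp only [id]
      refine ⟨by omega, ?_⟩
      rw [hd, Nat.add_sub_cancel_left]
      exact hup
    · obtain ⟨h1, h2⟩ := ih h
      refine ⟨by omega, ?_⟩
      have : G.graph.dist r w - G.graph.dist r u =
        (G.graph.dist r w - G.graph.dist r (G.nbr u j)) + 1 := by omega
      rw [this, Function.iterate_succ_apply', h2, hup]

/-- Conversely, every node that has `u` as an ancestor is in the subtree below `u`. -/
theorem mem_labels_of_ancestor {m k : ℕ} {u w : Fin n} (hk : 1 ≤ k) (hkm : k ≤ m)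
    (hd : G.graph.dist r w = G.graph.dist r u + k) (h : (G.bfsUp r)^[k] w = u) :
    w ∈ (G.bfsForest r id m u).labels := by
  induction m generalizing u k with
  | zero => omega
  | succ m ih =>
    obtain ⟨k, rfl⟩ := Nat.exists_eq_add_of_le' hk
    -- going up by one edge decreases the depth by at most one
    have hdist : ∀ i v, G.graph.dist r v ≤ G.graph.dist r ((G.bfsUp r)^[i] v) + i := by
      intro i
      induction i with
      | zero => intro v; exact le_rfl
      | succ i ihi =>
        intro v
        have h1 := ihi v
        rw [Function.iterate_succ_apply']
        generalize (G.bfsUp r)^[i] v = y at h1 ⊢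
        cases hy : G.bfsParent r y with
        | none =>
          rw [bfsUp, hy, Option.getD_none]
          omega
        | some z =>
          have := (G.bfsParent_eq_some r hy).2
          rw [bfsUp, hy, Option.getD_some]
          omega
    have h1 := hdist k w
    rw [Function.iterate_succ_apply'] at h
    generalize hy : (G.bfsUp r)^[k] w = y at h h1
    have hyr : y ≠ r := by
      rintro rfl
      rw [SimpleGraph.dist_self] at h1
      omega
    obtain ⟨z, hz⟩ := G.exists_bfsParent r hyr
    have hz' := G.bfsParent_eq_some r hz
    obtain rfl : z = u := by
      rw [← h, bfsUp, hz, Option.getD_some]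
    have hj : G.port z ⟨y, hz'.1.symm⟩ ∈ G.bfsChildPorts r z := by
      rw [mem_bfsChildPorts, nbr_port, hz]
    rw [labels_bfsForest_succ, List.mem_flatMap]
    refine ⟨_, hj, ?_⟩
    rw [nbr_port]
    rcases Nat.eq_zero_or_pos k with rfl | hk0
    · obtain rfl : w = y := hy
      exact List.mem_cons_self
    · exact List.mem_cons_of_mem _ (ih hk0 (by omega) (by omega) hy)

theorem dist_lt (u : Fin n) : G.graph.dist r u < n := by
  obtain ⟨p, hp, hl⟩ := G.connected.exists_path_of_dist r u
  rw [← hl]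
  simpa using hp.length_lt

/-- Every node other than the root is in the forest hanging from the root. -/
theorem mem_labels_root {w : Fin n} (hw : w ≠ r) : w ∈ (G.bfsForest r id n r).labels := by
  have hk : ∀ k v, G.graph.dist r v = k → (G.bfsUp r)^[k] v = r := by
    intro k
    induction k with
    | zero =>
      intro v hv
      exact ((G.connected.dist_eq_zero_iff).1 hv).symm
    | succ k ih =>
      intro v hv
      have hvr : v ≠ r := by
        rintro rfl
        rw [SimpleGraph.dist_self] at hv
        omega
      obtain ⟨z, hz⟩ := G.exists_bfsParent r hvr
      have := (G.bfsParent_eq_some r hz).2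
      rw [Function.iterate_succ_apply, bfsUp, hz, Option.getD_some]
      exact ih z (by omega)
  refine G.mem_labels_of_ancestor r (k := G.graph.dist r w) ?_ (G.dist_lt r w).le
    (by rw [SimpleGraph.dist_self, zero_add]) (hk _ w rfl)
  have := G.connected.pos_dist_of_ne hw.symm
  omega

theorem nodup_labels_bfsForest (m : ℕ) (u : Fin n) : (G.bfsForest r id m u).labels.Nodup := by
  induction m generalizing u with
  | zero => simp [bfsForest, PForest.labels]
  | succ m ih =>
    rw [labels_bfsForest_succ, List.nodup_flatMap]
    constructor
    · intro j _
      refine List.nodup_cons.2 ⟨fun h => ?_, ih _⟩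
      exact absurd (G.ancestor_of_mem_labels r h).1 (lt_irrefl _)
    · have hnd : (G.bfsChildPorts r u).Nodup := (List.nodup_finRange _).filter _
      refine hnd.imp_of_mem fun {j j'} hj hj' hne => ?_
      have hd := G.dist_nbr_of_mem_bfsChildPorts r hj
      have hd' := G.dist_nbr_of_mem_bfsChildPorts r hj'
      -- a node below `u` determines the child of `u` that it is below
      have key : ∀ i ∈ G.bfsChildPorts r u, ∀ w,
          w ∈ id (G.nbr u i) :: (G.bfsForest r id m (G.nbr u i)).labels →
          (G.bfsUp r)^[G.graph.dist r w - (G.graph.dist r u + 1)] w = G.nbr u i := by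
        intro i hi w hw
        have hdi := G.dist_nbr_of_mem_bfsChildPorts r hi
        rcases List.mem_cons.1 hw with rfl | hw
        · simp [hdi]
        · rw [← hdi]
          exact (G.ancestor_of_mem_labels r hw).2
      intro w hw hw'
      exact hne (G.nbr_injective u ((key j hj w hw).symm.trans (key j' hj' w hw')))

theorem size_bfsForest_le (lab : Fin n → α) (m : ℕ) (u : Fin n) :
    (G.bfsForest r lab m u).size ≤ n := by
  rw [← PForest.length_labels, labels_bfsForest, List.length_map]
  simpa using (G.nodup_labels_bfsForest r m u).length_le_card

theorem mem_labels_bfsForest_range (lab : Fin n → α) {m : ℕ} {u : Fin n} {x : α}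
    (h : x ∈ (G.bfsForest r lab m u).labels) : ∃ v, lab v = x := by
  rw [labels_bfsForest, List.mem_map] at h
  obtain ⟨v, -, hv⟩ := h
  exact ⟨v, hv⟩

theorem walk_bfsForest_lt (lab : Fin n → α) (m : ℕ) (u : Fin n) :
    ∀ p ∈ (G.bfsForest r lab m u).walk, p < n := by
  induction m generalizing u with
  | zero => simp [bfsForest, PForest.walk]
  | succ m ih =>
    rw [bfsForest_succ]
    induction G.bfsChildPorts r u with
    | nil => simp [PForest.walk]
    | cons j js ihj =>
      intro p hp
      have h1 := j.isLt.trans (G.deg_lt u)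
      have h2 := G.farPort_lt u j
      simp only [List.foldr_cons, PForest.walk, List.mem_cons, List.mem_append] at hp
      rcases hp with rfl | rfl | hp | rfl | rfl | hp
      · exact h1
      · exact h2
      · exact ih _ _ hp
      · exact h2
      · exact h1
      · exact ihj _ hp

theorem nbr_nbr_farPort (u : Fin n) (j : Fin (G.deg u)) (i : Fin (G.deg (G.nbr u j)))
    (h : G.farPort u j = i.val) : G.nbr (G.nbr u j) i = u := by
  have : G.port (G.nbr u j) ⟨u, (G.adj_nbr u j).symm⟩ = i := Fin.ext h
  rw [← this, nbr_port]

theorem portsAvoid_bfsForest (lab : Fin n → α) (m : ℕ) (u : Fin n) (e : Option ℕ)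
    (he : ∀ j ∈ G.bfsChildPorts r u, e ≠ some j.val) :
    (G.bfsForest r lab m u).PortsAvoid e := by
  induction m generalizing u e with
  | zero => trivial
  | succ m ih =>
    rw [bfsForest_succ]
    have hmem : ∀ j ∈ G.bfsChildPorts r u, G.bfsParent r (G.nbr u j) = some u := fun j hj =>
      (G.mem_bfsChildPorts r).1 hj
    generalize G.bfsChildPorts r u = js at he hmem ⊢
    induction js with
    | nil => trivial
    | cons j js ihj =>
      refine ⟨he j (by simp), ih _ _ fun i hi h => ?_,
        ihj (fun i hi => he i (by simp [hi])) fun i hi => hmem i (by simp [hi])⟩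
      -- otherwise `u` and its child would be parents of each other
      have h1 := (G.mem_bfsChildPorts r).1 hi
      rw [G.nbr_nbr_farPort u j i (Option.some.inj h)] at h1
      have h2 := (G.bfsParent_eq_some r h1).2
      have h3 := (G.bfsParent_eq_some r (hmem j (by simp))).2
      omega

/-- The path up the BFS tree from the node with the label of `v` is a shortest path of `G`. -/
theorem exists_walk_of_pathUp {lab : Fin n → ℕ} (hlab : Function.Injective lab) {v : Fin n}
    {m : ℕ} {u : Fin n} {l : List ℕ} (h : (G.bfsForest r lab m u).pathUp (lab v) = some l) :
    ∃ p : G.graph.Walk v u, G.portSeq p = l ∧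
      G.graph.dist r v = G.graph.dist r u + p.length := by
  induction m generalizing u l with
  | zero => simp [bfsForest, PForest.pathUp] at h
  | succ m ih =>
    rw [bfsForest_succ] at h
    have hmem : ∀ j ∈ G.bfsChildPorts r u, G.graph.dist r (G.nbr u j) = G.graph.dist r u + 1 :=
      fun j hj => G.dist_nbr_of_mem_bfsChildPorts r hj
    have hseq : ∀ j, G.portSeq (SimpleGraph.Walk.cons (G.adj_nbr u j).symm .nil) =
        [G.farPort u j, j.val] := by
      intro j
      simp [portSeq, farPort, port_nbr]
    generalize G.bfsChildPorts r u = js at h hmem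
    induction js with
    | nil => simp [PForest.pathUp] at h
    | cons j js ihj =>
      have hj := hmem j (by simp)
      rw [List.foldr_cons, PForest.pathUp] at h
      split_ifs at h with hv
      · obtain rfl := hlab hv
        exact ⟨_, (hseq j).trans (Option.some.inj h), by simp [hj]⟩
      · cases hc : (G.bfsForest r lab m (G.nbr u j)).pathUp (lab v) with
        | none =>
          rw [hc] at h
          exact ihj h fun i hi => hmem i (by simp [hi])
        | some l' =>
          rw [hc] at h
          obtain ⟨p, hp, hpl⟩ := ih hc
          refine ⟨p.append (.cons (G.adj_nbr u j).symm .nil), ?_, ?_⟩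
          · rw [portSeq_append, hp, hseq]
            exact Option.some.inj h
          · rw [hpl, hj, SimpleGraph.Walk.length_append]
            simp only [SimpleGraph.Walk.length_cons, SimpleGraph.Walk.length_nil]
            omega

/-- In the BFS tree labelled injectively, the path from the node with the label of `v` to the root
corresponds to a simple path from `v` to the root in `G`. -/
theorem exists_path_of_pathToRoot {lab : Fin n → ℕ} (hlab : Function.Injective lab) (v : Fin n) :
    ∃ p : G.graph.Walk v r, p.IsPath ∧
      (G.bfsTree r lab).pathToRoot (lab v) = some (G.portSeq p) := by
  by_cases hv : v = r
  · subst hv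
    exact ⟨.nil, .nil, by simp [PTree.pathToRoot, bfsTree, portSeq]⟩
  · have h : lab v ∈ (G.bfsForest r lab n r).labels := by
      rw [labels_bfsForest]
      exact List.mem_map_of_mem (G.mem_labels_root r hv)
    obtain ⟨l, hl⟩ := PForest.exists_pathUp h
    obtain ⟨p, hp, hlen⟩ := G.exists_walk_of_pathUp r hlab hl
    refine ⟨p, p.isPath_of_length_eq_dist ?_, ?_⟩
    · rw [SimpleGraph.dist_comm, hlen, SimpleGraph.dist_self, zero_add]
    · have hne : lab r ≠ lab v := fun h => hv (hlab h).symm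
      simp [PTree.pathToRoot, bfsTree, hne, hl, hp]

/-- The code of the labelled BFS tree has `O(n b)` bits as soon as `b` bits suffice for
port numbers and labels. -/
theorem length_code_bfsTree_le {lab : Fin n → ℕ} {b : ℕ} (hb : 1 ≤ b) (hn : 1 ≤ n)
    (hnb : n < 2 ^ b) (hlab : ∀ v, lab v ≤ n) :
    ((G.bfsTree r lab).code bin).length ≤ 52 * (n * b) := by
  have h := PTree.length_code_le (G.bfsTree r lab) (f := bin) (c := b) hb
    (fun p hp => (G.walk_bfsForest_lt r lab n r p hp).trans hnb) (by
      intro x hx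
      refine length_bin_le hb (lt_of_le_of_lt ?_ hnb)
      rcases List.mem_cons.1 hx with rfl | hx
      · exact hlab r
      · obtain ⟨v, rfl⟩ := G.mem_labels_bfsForest_range r lab hx
        exact hlab v)
  have hs : (G.bfsTree r lab).sub.size ≤ n := G.size_bfsForest_le r lab n r
  have h1 : 4 * (G.bfsTree r lab).sub.size * (2 * b + 2) ≤ 4 * n * (2 * b + 2) :=
    Nat.mul_le_mul_right _ (by omega)
  have h2 : ((G.bfsTree r lab).sub.size + 1) * (2 * b + 2) ≤ (n + n) * (2 * b + 2) :=
    Nat.mul_le_mul_right _ (by omega)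
  nlinarith [Nat.mul_le_mul_left n hb]

end PortGraph

/-! ### The length of the advice -/

theorem length_codeTrieList_le {b : ℕ} (hb : 2 ≤ b) (L : TrieList)
    (hL : ∀ c ∈ L, c.1 < 2 ^ b ∧ c.2.AllQueries (fun q => q.1 < 2 ^ b ∧ q.2 < 2 ^ b)) :
    (codeTrieList L).length ≤ 304 * ((L.map fun c => c.2.numLeaves).sum * b) := by
  refine (length_concat_couples_le (by omega) L fun c hc => (hL c hc).1).trans ?_
  induction L with
  | nil => simp
  | cons c L ih =>
    have h1 := ih fun c hc => hL c (by simp [hc])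
    have h2 := Trie.length_code_le hb (hL c (by simp)).2
    have h3 := Nat.mul_le_mul_right b (Trie.numLeaves_pos c.2)
    simp only [List.map_cons, List.sum_cons, add_mul] at h1 ⊢
    omega

theorem length_codeNestedList_le {b : ℕ} (hb : 2 ≤ b) (E₂ : NestedList)
    (hE₂ : ∀ c ∈ E₂, c.1 < 2 ^ b ∧
      ∀ c' ∈ c.2, c'.1 < 2 ^ b ∧ c'.2.AllQueries (fun q => q.1 < 2 ^ b ∧ q.2 < 2 ^ b)) :
    (codeNestedList E₂).length ≤ 4 * (E₂.length * b) + 608 * (leafCount E₂ * b) := by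
  refine (length_concat_couples_le (by omega) E₂ fun c hc => (hE₂ c hc).1).trans ?_
  induction E₂ with
  | nil => simp
  | cons c E₂ ih =>
    have h1 := ih fun c hc => hE₂ c (by simp [hc])
    have h2 := length_codeTrieList_le hb c.2 (hE₂ c (by simp)).2
    simp only [leafCount, List.map_cons, List.sum_cons, List.length_cons, add_mul] at h1 ⊢
    omega

theorem Trie.AllQueries.mono {P Q : ℕ × ℕ → Prop} (h : ∀ q, P q → Q q) {T : Trie}
    (hT : T.AllQueries P) : T.AllQueries Q := by
  induction T with
  | leaf => trivial
  | node q l r ihl ihr => exact ⟨h _ hT.1, ihl hT.2.1, ihr hT.2.2⟩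

/-- The lengths of the codes of views at depth `1`, which are compared by the queries of `E₁`, are
less than `2 ^ (2 * n.size + 5)`. -/
theorem size_mul_lt (n : ℕ) : n * (12 * n.size + 14) < 2 ^ (2 * n.size + 5) := by
  have h1 : n < 2 ^ n.size := Nat.lt_size_self n
  have h2 : n.size < 2 ^ n.size := Nat.lt_two_pow_self
  have h3 : 2 ^ (2 * n.size + 5) = 2 ^ n.size * (32 * 2 ^ n.size) := by ring
  rw [h3]
  exact Nat.mul_lt_mul_of_lt_of_le h1 (by omega) (by omega)

theorem size_bound {n : ℕ} (hn : 3 ≤ n) :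
    ((2 * n.size + 5 : ℕ) : ℝ) ≤ 9 * Real.logb 2 n := by
  have hL : 1 ≤ Real.logb 2 n := by
    rw [Real.le_logb_iff_rpow_le (by norm_num) (by positivity)]
    have : (3 : ℝ) ≤ n := by exact_mod_cast hn
    norm_num
    linarith
  have hs : 2 ^ (n.size - 1) ≤ n := by
    rw [← Nat.lt_size]
    have : 0 < n.size := Nat.size_pos.2 (by omega)
    omega
  have h : ((n.size - 1 : ℕ) : ℝ) ≤ Real.logb 2 n := by
    rw [Real.le_logb_iff_rpow_le (by norm_num) (by positivity), Real.rpow_natCast]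
    exact_mod_cast hs
  have h' : ((n.size : ℕ) : ℝ) ≤ ((n.size - 1 : ℕ) : ℝ) + 1 := by
    exact_mod_cast (by omega : n.size ≤ n.size - 1 + 1)
  push_cast
  linarith

/-- Here `b` bounds the number of bits of the integers in the advice, and `A` is the code of the
BFS tree. -/
theorem length_advice_le {φ n b : ℕ} {E₁ : Trie} {E₂ : NestedList} {A : Bits}
    (hn : 1 ≤ n) (hb : 2 ≤ b) (hφ : φ < 2 ^ b) (hE₁ : E₁.numLeaves ≤ n)
    (hE₁' : E₁.AllQueries (fun q => q.1 < 2 ^ b ∧ q.2 < 2 ^ b))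
    (hE₂ : E₂.length ≤ n) (hcount : leafCount E₂ ≤ 2 * n)
    (hE₂' : ∀ c ∈ E₂, c.1 < 2 ^ b ∧
      ∀ c' ∈ c.2, c'.1 < 2 ^ b ∧ c'.2.AllQueries (fun q => q.1 < 2 ^ b ∧ q.2 < 2 ^ b))
    (hA : A.length ≤ 52 * (n * b)) :
    (concat [bin φ, concat [E₁.code, codeNestedList E₂], A]).length ≤ 6000 * (n * b) := by
  have h1 := length_bin_le (by omega) hφ
  have h2 := Trie.length_code_le hb hE₁'
  have h3 := length_codeNestedList_le hb E₂ hE₂'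
  have h4 := length_concat_le [E₁.code, codeNestedList E₂]
  have h5 := length_concat_le [bin φ, concat [E₁.code, codeNestedList E₂], A]
  have h6 := Nat.mul_le_mul_right b hE₁
  have h7 := Nat.mul_le_mul_right b hE₂
  have h8 := Nat.mul_le_mul_right b hcount
  have h9 := Nat.mul_le_mul_right b hn
  rw [mul_assoc] at h8
  simp only [List.map_cons, List.sum_cons, List.map_nil, List.sum_nil] at h4 h5
  omega

/-! ### The advice and the election -/

section Advice

variable {n : ℕ} {G : PortGraph n}

/-- `ComputeAdvice` succeeds if its tries are built and label the nodes injectively, one of them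
by `1`. -/
theorem computeAdvice_eq {k : ℕ} {E₁ : Trie} {E₂ : NestedList} {lab : Fin n → ℕ}
    (hinj : Function.Injective lab) {r : Fin n} (hr : lab r = 1)
    (hE₁ : buildTrie k (G.views 1) none [] = some E₁)
    (hE₂ : G.nestedList k E₁ G.electionIndex = some E₂)
    (hlab : ∀ v, retrieveLabel E₁ E₂ (G.view G.electionIndex v) = some (lab v)) :
    computeAdvice k G = some (concat [bin G.electionIndex,
      concat [E₁.code, codeNestedList E₂], (G.bfsTree r lab).code bin]) := by
  have h1 : (List.finRange n).mapM
      (fun u => retrieveLabel E₁ E₂ (G.view G.electionIndex u)) =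
      some ((List.finRange n).map lab) := mapM_eq_some_map fun v _ => hlab v
  have h2 : ∀ u : Fin n, ((List.finRange n).map lab).getD u.val 0 = lab u := by
    intro u
    simp [List.getD_eq_getElem?_getD]
  have h3 : (List.finRange n).find? (fun u => decide (lab u = 1)) = some r := by
    cases h : (List.finRange n).find? (fun u => decide (lab u = 1)) with
    | none =>
      rw [List.find?_eq_none] at h
      exact absurd (decide_eq_true hr) (h r (List.mem_finRange r))
    | some s =>
      have hs := List.find?_some h
      rw [decide_eq_true_eq] at hs
      rw [hinj (hs.trans hr.symm)]
  simp only [computeAdvice, hE₁, hE₂, h1, h2, h3, Option.bind_eq_bind, Option.bind_some,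
    Option.pure_def]

/-- With injective labels, all nodes stop exactly at the election index, with paths to the root
of the BFS tree. -/
theorem electsWithin_elect {E₁ : Trie} {E₂ : NestedList} {lab : Fin n → ℕ}
    (hinj : Function.Injective lab) (r : Fin n)
    (hlab : ∀ v, retrieveLabel E₁ E₂ (G.view G.electionIndex v) = some (lab v)) :
    (elect (concat [bin G.electionIndex, concat [E₁.code, codeNestedList E₂],
      (G.bfsTree r lab).code bin])).ElectsWithin G G.electionIndex := by
  have hdec := decodeAdvice_concat G.electionIndex E₁ E₂ (G.bfsTree r lab)
    (G.portsAvoid_bfsForest r lab n r none fun _ _ => by simp)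
  have hpath := fun v => G.exists_path_of_pathToRoot r hinj v
  choose p hp hpr using hpath
  refine ⟨fun v => G.portSeq (p v), fun v => ⟨_, le_rfl, ?_, fun t ht => ?_⟩,
    r, fun v => ⟨p v, hp v, rfl⟩⟩
  · simp only [elect, hdec, hlab, hpr, Option.bind_eq_bind, Option.bind_some, if_true]
  · simp only [elect, hdec, Option.bind_eq_bind, Option.bind_some, if_neg ht.ne]

end Advice

end Election

theorem mainTheorem1 :
    ∃ C : ℝ, ∀ (n : ℕ), 3 ≤ n → ∀ G : Election.PortGraph n, G.Feasible →
      ∃ adv : Election.Bits,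
        Election.ComputeAdviceReturns G adv ∧
        (adv.length : ℝ) ≤ C * (n * Real.logb 2 n) ∧
        IsLeast {t : ℕ | (Election.elect adv).ElectsWithin G t} G.electionIndex ∧
        ∀ (alg : Election.LocalAlgorithm) (t : ℕ),
          alg.ElectsWithin G t → G.electionIndex ≤ t := by
  -- the advice has at most `6000 n b` bits, where `b = 2 * n.size + 5 ≤ 9 log₂ n`
  refine ⟨54000, fun n hn G hG => ?_⟩
  have : NeZero n := ⟨by omega⟩
  have hlower : ∀ (alg : Election.LocalAlgorithm) (t : ℕ),
      alg.ElectsWithin G t → G.electionIndex ≤ t := fun alg t h => Nat.sInf_le ⟨alg, h⟩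
  have hφ := G.electionIndex_le hG
  obtain ⟨d, hd⟩ := Nat.exists_eq_add_of_le' (G.electionIndex_pos (by omega) hG)
  have hns : n < 2 ^ n.size := Nat.lt_size_self n
  have hs : 1 ≤ n.size := Nat.size_pos.2 (by omega)
  obtain ⟨E₁, hE₁, hleaves, hq₁, f₁, hf₁⟩ := Election.exists_trie_one G (by omega)
    (G.length_code_view_one_le hs hns.le)
  have hlist := Election.exists_nestedList (n := n) (G := G) (by omega) ⟨f₁, hf₁ []⟩ d
  rw [show d + 1 = G.electionIndex from hd.symm] at hlist
  obtain ⟨E₂, hE₂, ⟨f, hf⟩, hlen, hcount, hq₂⟩ := hlist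
  have hinj : Function.Injective fun v => f (G.view G.electionIndex v) := fun u v h =>
    G.view_electionIndex_injective hG (hf.inj u v h)
  -- the labels fill `{1, …, n}`, so that one of them is `1`
  obtain ⟨r, hr⟩ : ∃ r, f (G.view G.electionIndex r) = 1 := by
    have h1 : 1 ∈ Finset.Icc 1 (G.numViews G.electionIndex) :=
      Finset.mem_Icc.2 ⟨le_rfl, (hf.pos 0).trans (hf.le 0)⟩
    rw [← hf.image_eq] at h1
    simpa using h1
  refine ⟨_, ⟨n, fun k hk => Election.computeAdvice_eq hinj hr (hE₁ k hk) (hE₂ k hk) hf.retrieve⟩,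
    ?_, ⟨Election.electsWithin_elect hinj r hf.retrieve, fun t ht => hlower _ t ht⟩, hlower⟩
  have hnb : n < 2 ^ (2 * n.size + 5) :=
    hns.trans_le (Nat.pow_le_pow_right (by norm_num) (by omega))
  have hM := Election.size_mul_lt n
  have hlength := Election.length_advice_le (φ := G.electionIndex) (E₁ := E₁) (E₂ := E₂)
    (b := 2 * n.size + 5) (n := n) (by omega) (by omega) (hφ.trans_lt hnb)
    (hleaves.trans_le (G.numViews_le 1)) (hq₁.mono fun q hq => ⟨by omega, by omega⟩)
    (by omega) (by have := G.numViews_le G.electionIndex; omega)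
    (fun c hc => ⟨by have := (hq₂ c hc).1; omega, fun c' hc' =>
      ⟨((hq₂ c hc).2 c' hc').1.trans_lt hnb,
        ((hq₂ c hc).2 c' hc').2.mono fun q hq => ⟨by omega, by omega⟩⟩⟩)
    (G.length_code_bfsTree_le r (by omega) (by omega) hnb
      fun v => (hf.le v).trans (G.numViews_le _))
  refine (Nat.cast_le.2 hlength).trans ?_
  have hlog := Election.size_bound hn
  push_cast at hlog ⊢
  have := mul_le_mul_of_nonneg_left hlog (Nat.cast_nonneg (α := ℝ) n)
  linarith
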